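/- Let $\mathcal{F}$ be a signature, $\mathcal{V}$ an infinite set of variables, and let $\mathrm{AC}$ consist of the equations $f(x,y)\approx f(y,x)$ and $f(f(x,y),z)\approx f(x,f(y,z))$ for the function symbols $f$ in a given set of binary symbols of $\mathcal{F}$. Equational systems (ESs) and term rewrite systems (TRSs) are sets of ordered pairs of terms over $\mathcal{F},\mathcal{V}$; in a TRS no left-hand side is a variable and every variable of a right-hand side occurs in the left-hand side. Write $\to_{\mathcal{R}}$ for the rewrite relation, $\sim$ for $\leftrightarrow^*_{\mathrm{AC}}$, $\to_{\mathcal{R}/\mathrm{AC}}$ for ${\sim}\cdot{\to_{\mathcal{R}}}\cdot{\sim}$, ${\downarrow^{\sim}_{\mathcal{R}}}$ for $\to^*_{\mathcal{R}}\cdot\sim\cdot\,{}^*_{\mathcal{R}}{\leftarrow}$, and $\mathcal{E}^{\pm}=\mathcal{E}\cup\{t\approx s\mid s\approx t\in\mathcal{E}\}$. Fix an AC-compatible reduction order $>$ (transitive, well-founded, closed under contexts and substitutions, ${\sim}\cdot{>}\cdot{\sim}\subseteq{>}$). The inference system $\mathcal{I}_A$ has the following rules on pairs $(\mathcal{E},\mathcal{R})$,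 where $s\mathrel{\dot\approx}t$ stands for $s\approx t$ or $t\approx s$ and $\uplus$ is disjoint union: * deduce (peak): $(\mathcal{E},\mathcal{R})\Rightarrow(\mathcal{E}\cup\{s\approx t\},\mathcal{R})$ if $s\leftarrow_{\mathcal{R}}\cdot\to_{\mathcal{R}}t$; * deduce (cliff): $(\mathcal{E},\mathcal{R})\Rightarrow(\mathcal{E},\mathcal{R}\cup\{t\to s\})$ if $s\leftarrow_{\mathcal{R}}\cdot\leftrightarrow_{\mathrm{AC}}t$; * orient: $(\mathcal{E}\uplus\{s\mathrel{\dot\approx}t\},\mathcal{R})\Rightarrow(\mathcal{E},\mathcal{R}\cup\{s\to t\})$ if $s>t$; * delete: $(\mathcal{E}\uplus\{s\approx t\},\mathcal{R})\Rightarrow(\mathcal{E},\mathcal{R})$ if $s\sim t$; * simplify: $(\mathcal{E}\uplus\{s\mathrel{\dot\approx}t\},\mathcal{R})\Rightarrow(\mathcal{E}\cup\{u\approx t\},\mathcal{R})$ if $s\to_{\mathcal{R}/\mathrm{AC}}u$; * collapse: $(\mathcal{E},\mathcal{R}\uplus\{s\to t\})\Rightarrow(\mathcal{E}\cup\{u\approx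 t\},\mathcal{R})$ if $s\to_{\mathcal{R}}u$; * compose: $(\mathcal{E},\mathcal{R}\uplus\{s\to t\})\Rightarrow(\mathcal{E},\mathcal{R}\cup\{s\to u\})$ if $t\to_{\mathcal{R}/\mathrm{AC}}u$. General AC completion $\mathrm{KB}_{\mathrm{AC}}$ has the same rules, except that collapse requires only $s\to_{\mathcal{R}/\mathrm{AC}}u$ and the two deduce rules are replaced by $(\mathcal{E},\mathcal{R})\Rightarrow(\mathcal{E}\cup\{s\approx t\},\mathcal{R})$ if $s\leftarrow_{\mathcal{R}}\cdot\sim\cdot\to_{\mathcal{R}}t$. A critical peak $t\leftarrow s\to u$, obtained as usual from an overlap of variable-disjoint variants of two rules at a non-variable position $p$ with a most general unifier (excluding an overlap of a rule with its own variant at the root), is prime if all proper subterms of $s|_p$ are $\mathcal{R}$-normal forms. Let $\mathrm{PCP}(\mathcal{R})$ be the set of the prime critical pairs $t\approx u$ of $\mathcal{R}$, and $\mathrm{PCP}^{\pm}(\mathcal{R},\mathrm{AC}^{\pm})$ the set of those from overlaps, in either direction, between $\mathcal{R}$ and $\mathrm{AC}^{\pm}$, primality always being with respect to $\mathcal{R}$.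 A run $(\mathcal{E}_0,\mathcal{R}_0)\Rightarrow_{\mathcal{I}_A}\cdots\Rightarrow_{\mathcal{I}_A}(\mathcal{E}_n,\mathcal{R}_n)$ with $\mathcal{R}_0=\varnothing$ is fair if $\mathcal{R}_n$ is left-linear, $$\mathrm{PCP}(\mathcal{R}_n)\subseteq{\downarrow^{\sim}_{\mathcal{R}_n}}\cup\bigcup_{i=0}^n{\leftrightarrow_{\mathcal{E}_i\cup\mathcal{R}_i}}\quad\text{and}\quad\mathrm{PCP}^{\pm}(\mathcal{R}_n,\mathrm{AC}^{\pm})\subseteq{\downarrow^{\sim}_{\mathcal{R}_n}}\cup\bigcup_{i=0}^n{\leftrightarrow_{\mathcal{R}_i}}.$$ **Theorem.** Let $(\mathcal{E}_0,\varnothing)=(\mathcal{E}_0,\mathcal{R}_0)\Rightarrow_{\mathcal{I}_A}\cdots\Rightarrow_{\mathcal{I}_A}(\mathcal{E}_n,\mathcal{R}_n)$ be any run. Then there are ESs $\mathcal{E}'_0,\dots,\mathcal{E}'_n$ and TRSs $\mathcal{R}'_0,\dots,\mathcal{R}'_n$ with $\mathcal{E}'_0=\mathcal{E}_0$, $\mathcal{R}'_0=\varnothing$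 such that $(\mathcal{E}'_i,\mathcal{R}'_i)\Rightarrow^*_{\mathrm{KB}_{\mathrm{AC}}}(\mathcal{E}'_{i+1},\mathcal{R}'_{i+1})$ for all $i<n$ (with the same order $>$) and, for all $i\le n$, $(\mathcal{E}'_i)^{\pm}=\mathcal{E}_i^{\pm}$ and $\mathcal{R}_i\subseteq{\to^+_{\mathcal{R}'_i/\mathrm{AC}}}$ (so one can switch from $\mathcal{I}_A$ to general AC completion at any point). Moreover, if the given run is fair and $\mathcal{E}_n=\varnothing$, then $(\mathcal{E}_0,\varnothing)\Rightarrow^*_{\mathrm{KB}_{\mathrm{AC}}}(\varnothing,\mathcal{R}'_n)$ and $\mathcal{R}'_n/\mathrm{AC}$ is an AC-complete presentation of $\mathcal{E}_0$: the relation $\to_{\mathcal{R}'_n/\mathrm{AC}}$ is terminating modulo AC and Church--Rosser modulo AC (every conversion consisting of $\to_{\mathcal{R}'_n/\mathrm{AC}}$-steps, their inverses and $\sim$-steps connects terms related by $\to^*_{\mathcal{R}'_n/\mathrm{AC}}\cdot\sim\cdot\,{}^*_{\mathcal{R}'_n/\mathrm{AC}}{\leftarrow}$), and ${\leftrightarrow^*_{\mathcal{E}_0\cup\mathrm{AC}}}={\leftrightarrow^*_{\mathcal{R}'_n\cup\mathrm{AC}}}$.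 -/

import Mathlib

namespace ACCompletion

universe u v

/-! ### Abstract rewriting modulo an equivalence relation -/

section Abstract

variable {A : Type u}

/-- Conversion: the reflexive, symmetric and transitive closure of `r`. -/
def Conv (r : A → A → Prop) : A → A → Prop :=
  Relation.ReflTransGen (fun a b => r a b ∨ r b a)

/-- Rewriting modulo `sim`, i.e. the composition of `sim`, `r` and `sim`. -/
def Modulo (r sim : A → A → Prop) (a b : A) : Prop :=
  ∃ a' b', sim a a' ∧ r a' b' ∧ sim b' b

/-- Conversion modulo `sim`: every step is an `r`-step, a reversed `r`-step or a `sim`-step. -/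
def ConvModulo (r sim : A → A → Prop) : A → A → Prop :=
  Relation.ReflTransGen (fun a b => r a b ∨ r b a ∨ sim a b)

/-- Valley modulo `sim`. -/
def Valley (r sim : A → A → Prop) (a b : A) : Prop :=
  ∃ a' b', Relation.ReflTransGen r a a' ∧ sim a' b' ∧ Relation.ReflTransGen r b b'

/-- `r` is terminating: there is no infinite sequence `a₀ r a₁ r a₂ r ⋯`. -/
def Terminating (r : A → A → Prop) : Prop :=
  ¬ ∃ a : ℕ → A, ∀ i, r (a i) (a (i + 1))

/-- Church–Rosser modulo `sim`. -/
def ChurchRosserModulo (r sim : A → A → Prop) : Prop :=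
  ∀ a b, ConvModulo r sim a b → Valley r sim a b

/-- Complete modulo `sim`: terminating modulo `sim` and Church–Rosser modulo `sim`. -/
def CompleteModulo (r sim : A → A → Prop) : Prop :=
  Terminating (Modulo r sim) ∧ ChurchRosserModulo r sim

end Abstract

/-! ### Terms, substitutions and contexts -/

/-- First-order terms over the signature `F` with arities `ar` and the variables `V`. -/
inductive Term {F : Type u} (ar : F → ℕ) (V : Type v) : Type (max u v)
  | var (x : V) : Term ar V
  | app (f : F) (ts : Fin (ar f) → Term ar V) : Term ar V

section Terms

variable {F : Type u} {ar : F → ℕ} {V : Type v}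

namespace Term

/-- The set of variables of a term. -/
def vars : Term ar V → Set V
  | var x => {x}
  | app _ ts => ⋃ i, (ts i).vars

/-- The term is a variable. -/
def IsVar (t : Term ar V) : Prop := ∃ x, t = var x

/-- Application of a substitution. -/
def subst (σ : V → Term ar V) : Term ar V → Term ar V
  | var x => σ x
  | app f ts => app f (fun i => (ts i).subst σ)

/-- Application of a renaming (a bijection on the variables). -/
def rename (π : Equiv.Perm V) (t : Term ar V) : Term ar V := t.subst (fun x => var (π x))

/-- No variable occurs more than once. -/
def IsLinear : Term ar V → Prop
  | var _ => True
  | app _ ts => (∀ i, (ts i).IsLinear) ∧ ∀ i j, i ≠ j → Disjoint (ts i).vars (ts j).vars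

/-- `f(s, t)` for a binary function symbol `f`. -/
def app₂ (f : F) (s t : Term ar V) : Term ar V :=
  app f (fun i => if i.val = 0 then s else t)

end Term

/-- One-hole contexts. In `arg f i ts C` the hole lies in the `i`-th argument, which is `C`
(the entry `ts i` is ignored). A context stands for the position of its hole. -/
inductive Ctx {F : Type u} (ar : F → ℕ) (V : Type v) : Type (max u v)
  | hole : Ctx ar V
  | arg (f : F) (i : Fin (ar f)) (ts : Fin (ar f) → Term ar V) (C : Ctx ar V) : Ctx ar V

namespace Ctx

/-- `C.fill t` is `C[t]`. -/
def fill : Ctx ar V → Term ar V → Term ar V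
  | hole, t => t
  | arg f i ts C, t => Term.app f (Function.update ts i (C.fill t))

/-- Application of a substitution to a context. -/
def subst (σ : V → Term ar V) : Ctx ar V → Ctx ar V
  | hole => hole
  | arg f i ts C => arg f i (fun j => (ts j).subst σ) (C.subst σ)

end Ctx

/-- `u` is a proper subterm of `t`. -/
def ProperSubterm (u t : Term ar V) : Prop := ∃ C : Ctx ar V, C ≠ Ctx.hole ∧ t = C.fill u

/-! ### Equational systems and term rewrite systems, as sets of pairs of terms -/

/-- The rewrite relation of a set of pairs. -/
def Step (E : Set (Term ar V × Term ar V)) (s t : Term ar V) : Prop :=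
  ∃ l r, (l, r) ∈ E ∧ ∃ (C : Ctx ar V) (σ : V → Term ar V),
    s = C.fill (l.subst σ) ∧ t = C.fill (r.subst σ)

/-- One step from left to right or from right to left. -/
def SymStep (E : Set (Term ar V × Term ar V)) (s t : Term ar V) : Prop :=
  Step E s t ∨ Step E t s

/-- The equational theory of `E`. -/
def EqTheory (E : Set (Term ar V × Term ar V)) : Term ar V → Term ar V → Prop :=
  Conv (Step E)

/-- `E` together with all reversed equations. -/
def symmEqs (E : Set (Term ar V × Term ar V)) : Set (Term ar V × Term ar V) :=
  {e | e ∈ E ∨ e.swap ∈ E}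

/-- Term rewrite systems: left-hand sides are not variables, and every variable of a right-hand
side occurs in the left-hand side. -/
def IsTRS (R : Set (Term ar V × Term ar V)) : Prop :=
  ∀ l r, (l, r) ∈ R → ¬ l.IsVar ∧ r.vars ⊆ l.vars

/-- Left-linearity. -/
def LeftLinear (R : Set (Term ar V × Term ar V)) : Prop :=
  ∀ l r, (l, r) ∈ R → l.IsLinear

/-- `t` is a normal form of `R`. -/
def IsNF (R : Set (Term ar V × Term ar V)) (t : Term ar V) : Prop := ∀ u, ¬ Step R t u

/-- The rewrite relation `R/B`. -/
def StepMod (R B : Set (Term ar V × Term ar V)) : Term ar V → Term ar V → Prop :=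
  Modulo (Step R) (EqTheory B)

/-- `B`-compatible reduction orders. -/
structure IsReductionOrder (B : Set (Term ar V × Term ar V))
    (gt : Term ar V → Term ar V → Prop) : Prop where
  trans : ∀ s t u, gt s t → gt t u → gt s u
  wf : Terminating gt
  ctx : ∀ (C : Ctx ar V) s t, gt s t → gt (C.fill s) (C.fill t)
  subst : ∀ (σ : V → Term ar V) s t, gt s t → gt (s.subst σ) (t.subst σ)
  compat : ∀ s s' t' t, EqTheory B s s' → gt s' t' → EqTheory B t' t → gt s t

/-- The equations `f(x, y) ≈ f(y, x)` and `f(f(x, y), z) ≈ f(x, f(y, z))` for `f` in `ac`. -/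
def AC (ac : Set F) : Set (Term ar V × Term ar V) :=
  {e | ∃ f ∈ ac, ∃ x y : V, x ≠ y ∧
      e = (Term.app₂ f (.var x) (.var y), Term.app₂ f (.var y) (.var x))} ∪
  {e | ∃ f ∈ ac, ∃ x y z : V, x ≠ y ∧ y ≠ z ∧ x ≠ z ∧
      e = (Term.app₂ f (Term.app₂ f (.var x) (.var y)) (.var z),
           Term.app₂ f (.var x) (Term.app₂ f (.var y) (.var z)))}

/-! ### Prime critical pairs -/

/-- The pairs `ρ` and `ρ'` are variants. -/
def IsVariant (ρ ρ' : Term ar V × Term ar V) : Prop :=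
  ∃ π : Equiv.Perm V, ρ.1.rename π = ρ'.1 ∧ ρ.2.rename π = ρ'.2

/-- `σ` is a most general unifier of `s` and `t`. -/
def IsMGU (σ : V → Term ar V) (s t : Term ar V) : Prop :=
  s.subst σ = t.subst σ ∧
    ∀ τ : V → Term ar V, s.subst τ = t.subst τ →
      ∃ δ : V → Term ar V, ∀ x, τ x = (σ x).subst δ

/-- `CriticalPeak R₁ R₂ t w s u`: some overlap of a rule `l₁ → r₁` of `R₁` inside a rule
`l₂ → r₂` of `R₂` gives the critical peak `t ← s → u`, where `s = l₂σ`, `u = r₂σ`, and `t` is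
obtained from `s` by contracting the subterm `w = l₁σ` to `r₁σ`. The position of the overlap is
that of the hole of `C` in `l₂ = C[m]`. -/
def CriticalPeak (R₁ R₂ : Set (Term ar V × Term ar V)) (t w s u : Term ar V) : Prop :=
  ∃ l₁ r₁ l₂ r₂ : Term ar V,
    (∃ ρ ∈ R₁, IsVariant ρ (l₁, r₁)) ∧ (∃ ρ ∈ R₂, IsVariant ρ (l₂, r₂)) ∧
    Disjoint (l₁.vars ∪ r₁.vars) (l₂.vars ∪ r₂.vars) ∧
    ∃ (C : Ctx ar V) (m : Term ar V) (σ : V → Term ar V),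
      l₂ = C.fill m ∧ ¬ m.IsVar ∧ IsMGU σ l₁ m ∧
      (C = Ctx.hole → ¬ IsVariant (l₁, r₁) (l₂, r₂)) ∧
      t = (C.subst σ).fill (r₁.subst σ) ∧ w = l₁.subst σ ∧ s = l₂.subst σ ∧ u = r₂.subst σ

/-- Critical pairs between `R₁` and `R₂` whose peak is prime with respect to `R`: all proper
subterms of the contracted subterm are in normal form with respect to `R`. -/
def PrimeCP (R R₁ R₂ : Set (Term ar V × Term ar V)) : Set (Term ar V × Term ar V) :=
  {e | ∃ w s, CriticalPeak R₁ R₂ e.1 w s e.2 ∧ ∀ v, ProperSubterm v w → IsNF R v}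

/-- The prime critical pairs of `R`. -/
def PCP (R : Set (Term ar V × Term ar V)) : Set (Term ar V × Term ar V) := PrimeCP R R R

/-- The prime critical pairs (in both directions) between `R` and the equations of `B`, used from
left to right and from right to left; primality is with respect to `R`. -/
def PCPpm (R B : Set (Term ar V × Term ar V)) : Set (Term ar V × Term ar V) :=
  PrimeCP R R (symmEqs B) ∪ PrimeCP R (symmEqs B) R

/-! ### The two inference systems -/

/-- Pairs consisting of a set of equations and a set of rules. -/
abbrev State {F : Type u} (ar : F → ℕ) (V : Type v) : Type (max u v) :=
  Set (Term ar V × Term ar V) × Set (Term ar V × Term ar V)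

/-- The inference system for left-linear completion modulo `B` with respect to the order `gt`.
In a premise, a disjoint union with a singleton is a union together with a non-membership. -/
inductive IA (B : Set (Term ar V × Term ar V)) (gt : Term ar V → Term ar V → Prop) :
    State ar V → State ar V → Prop
  | deducePeak (E R : Set (Term ar V × Term ar V)) (s m t : Term ar V)
      (h₁ : Step R m s) (h₂ : Step R m t) : IA B gt (E, R) (E ∪ {(s, t)}, R)
  | deduceCliff (E R : Set (Term ar V × Term ar V)) (s m t : Term ar V)
      (h₁ : Step R m s) (h₂ : SymStep B m t) : IA B gt (E, R) (E, R ∪ {(t, s)})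
  | orient (E R : Set (Term ar V × Term ar V)) (s t : Term ar V) (e : Term ar V × Term ar V)
      (he : e = (s, t) ∨ e = (t, s)) (hd : e ∉ E) (h : gt s t) :
      IA B gt (E ∪ {e}, R) (E, R ∪ {(s, t)})
  | delete (E R : Set (Term ar V × Term ar V)) (s t : Term ar V)
      (hd : (s, t) ∉ E) (h : EqTheory B s t) : IA B gt (E ∪ {(s, t)}, R) (E, R)
  | simplify (E R : Set (Term ar V × Term ar V)) (s t u : Term ar V) (e : Term ar V × Term ar V)
      (he : e = (s, t) ∨ e = (t, s)) (hd : e ∉ E) (h : StepMod R B s u) :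
      IA B gt (E ∪ {e}, R) (E ∪ {(u, t)}, R)
  | collapse (E R : Set (Term ar V × Term ar V)) (s t u : Term ar V)
      (hd : (s, t) ∉ R) (h : Step R s u) : IA B gt (E, R ∪ {(s, t)}) (E ∪ {(u, t)}, R)
  | compose (E R : Set (Term ar V × Term ar V)) (s t u : Term ar V)
      (hd : (s, t) ∉ R) (h : StepMod R B t u) : IA B gt (E, R ∪ {(s, t)}) (E, R ∪ {(s, u)})

/-- The inference system for general completion modulo `B` with respect to the order `gt`; for
`B = AC` this is general AC completion. It differs from `IA` in the deduction rule and in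
collapsing modulo `B`. -/
inductive KB (B : Set (Term ar V × Term ar V)) (gt : Term ar V → Term ar V → Prop) :
    State ar V → State ar V → Prop
  | deduce (E R : Set (Term ar V × Term ar V)) (s m m' t : Term ar V)
      (h₁ : Step R m s) (h₂ : EqTheory B m m') (h₃ : Step R m' t) :
      KB B gt (E, R) (E ∪ {(s, t)}, R)
  | orient (E R : Set (Term ar V × Term ar V)) (s t : Term ar V) (e : Term ar V × Term ar V)
      (he : e = (s, t) ∨ e = (t, s)) (hd : e ∉ E) (h : gt s t) :
      KB B gt (E ∪ {e}, R) (E, R ∪ {(s, t)})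
  | delete (E R : Set (Term ar V × Term ar V)) (s t : Term ar V)
      (hd : (s, t) ∉ E) (h : EqTheory B s t) : KB B gt (E ∪ {(s, t)}, R) (E, R)
  | simplify (E R : Set (Term ar V × Term ar V)) (s t u : Term ar V) (e : Term ar V × Term ar V)
      (he : e = (s, t) ∨ e = (t, s)) (hd : e ∉ E) (h : StepMod R B s u) :
      KB B gt (E ∪ {e}, R) (E ∪ {(u, t)}, R)
  | collapse (E R : Set (Term ar V × Term ar V)) (s t u : Term ar V)
      (hd : (s, t) ∉ R) (h : StepMod R B s u) : KB B gt (E, R ∪ {(s, t)}) (E ∪ {(u, t)}, R)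
  | compose (E R : Set (Term ar V × Term ar V)) (s t u : Term ar V)
      (hd : (s, t) ∉ R) (h : StepMod R B t u) : KB B gt (E, R ∪ {(s, t)}) (E, R ∪ {(s, u)})

/-- `(E 0, R 0), …, (E n, R n)` is a run of `IA` for the equational system `E 0`. -/
def IsRunIA (B : Set (Term ar V × Term ar V)) (gt : Term ar V → Term ar V → Prop) (n : ℕ)
    (E R : ℕ → Set (Term ar V × Term ar V)) : Prop :=
  R 0 = ∅ ∧ ∀ i < n, IA B gt (E i, R i) (E (i + 1), R (i + 1))

/-- Fairness of a run of `IA` of length `n`. -/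
def IsFairIA (B : Set (Term ar V × Term ar V)) (n : ℕ)
    (E R : ℕ → Set (Term ar V × Term ar V)) : Prop :=
  LeftLinear (R n) ∧
  (∀ s t, (s, t) ∈ PCP (R n) →
    Valley (Step (R n)) (EqTheory B) s t ∨ ∃ i ≤ n, SymStep (E i ∪ R i) s t) ∧
  (∀ s t, (s, t) ∈ PCPpm (R n) B →
    Valley (Step (R n)) (EqTheory B) s t ∨ ∃ i ≤ n, SymStep (R i) s t)

/-- `R/B` is a `B`-complete presentation of `E`: the relation `R/B` is complete modulo `B`, and
`R` and `E` induce the same equational theory together with `B`. -/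
def IsCompletePresentationMod (B R E : Set (Term ar V × Term ar V)) : Prop :=
  CompleteModulo (StepMod R B) (EqTheory B) ∧
    ∀ s t, EqTheory (E ∪ B) s t ↔ EqTheory (R ∪ B) s t

end Terms

end ACCompletion

open ACCompletion

/-!
General completion simulates left-linear completion with a set of rules that only grows: it takes
over the oriented equations and never composes or collapses. The invariant (`Simulates`) is that
every rule `l → r` of the simulated run satisfies `l ∼ · →_{R'} · →*_{R'/B} r` (`LeadsTo`). A rule
deduced from a cliff then satisfies the invariant at once, and an equation produced by a peak or by
a collapse comes from a peak of `R'/B`, so it can be deduced and simplified to the required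
equation. Since a simplification step reverses an equation whose right-hand side is rewritten, such
an equation is obtained only up to orientation; it can be derived again whenever the simulated run
treats its two orientations differently (`Simulates.exists_replace`). Equations that do not come
from peaks agree exactly, because a sequence of simplification steps can be arranged not to destroy
other equations (`KB.simplify_transGen`).

For a fair run with `E n = ∅` the system `R n` is Church–Rosser modulo `B`. Conversions below a term
`m` survive every inference, and a term reducible by `R i` stays reducible, with a reduct connected
to the old one below the term (`IsRunIA.convBelow`, `IsRunIA.exists_step`); this uses that
collapsing does not work modulo `B`. By fairness, prime critical peaks `s ← m → t` of `R n` are connected below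
`m`, and in prime critical cliffs `s ← m ↔ t` the term `t` has a reduct connected to `s` below `m`
(`IsRunIA.primeCriticalConditions`). Most general unifiers (`exists_mgu_list`) and splitting a peak
or cliff at an innermost redex extend this from prime critical peaks and cliffs to all of them
(`PrimeCriticalConditions.convBelow_of_peak`, `PrimeCriticalConditions.convBelow_of_cliff`);
left-linearity of `R n` and linearity of `B` deal with overlaps in variables. Well-founded induction
on the order then shows that `B`-equivalent terms have `B`-equivalent normal forms
(`churchRosserModulo_of_peaks_of_cliffs`). The three systems `E 0`, `R n` and `R' n` have the same
theory modulo `B`, and steps of `R n` are sequences of steps of `R' n / B`, so the valleys of `R n`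
are valleys of `R' n / B` (`completeModulo_of_leadsTo`).
-/

namespace ACCompletion

universe u v

section Terms

variable {F : Type u} {ar : F → ℕ} {V : Type v}

/-! ### Substitutions and contexts -/

namespace Term

theorem subst_congr {σ τ : V → Term ar V} (t : Term ar V) (h : ∀ x ∈ t.vars, σ x = τ x) :
    t.subst σ = t.subst τ := by
  induction t with
  | var x => exact h x rfl
  | app f ts ih =>
    simp only [subst, app.injEq, heq_eq_eq, true_and]
    funext i
    exact ih i fun x hx => h x (Set.mem_iUnion.2 ⟨i, hx⟩)

theorem subst_subst (σ τ : V → Term ar V) (t : Term ar V) :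
    (t.subst σ).subst τ = t.subst fun x => (σ x).subst τ := by
  induction t with
  | var x => rfl
  | app f ts ih => simp only [subst, ih]

theorem subst_var (t : Term ar V) : t.subst var = t := by
  induction t with
  | var x => rfl
  | app f ts ih => simp only [subst, ih]

theorem subst_rename (π : Equiv.Perm V) (σ : V → Term ar V) (t : Term ar V) :
    (t.rename π).subst σ = t.subst fun x => σ (π x) := by
  simp only [rename, subst_subst, subst]

theorem vars_rename (π : Equiv.Perm V) (t : Term ar V) : (t.rename π).vars = π '' t.vars := by
  induction t with
  | var x => simp [rename, subst, vars]
  | app f ts ih =>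
    simp only [rename] at ih
    simp only [rename, subst, vars, Set.image_iUnion, ih]

theorem finite_vars (t : Term ar V) : t.vars.Finite := by
  induction t with
  | var x => exact Set.finite_singleton x
  | app f ts ih => exact Set.finite_iUnion ih

/-- The number of symbols of a term. -/
def size : Term ar V → ℕ
  | var _ => 1
  | app _ ts => 1 + ∑ i, (ts i).size

theorem size_pos (t : Term ar V) : 0 < t.size := by
  cases t <;> simp only [size] <;> omega

theorem size_arg_lt (f : F) (ts : Fin (ar f) → Term ar V) (i : Fin (ar f)) :
    (ts i).size < (app f ts).size := by
  have := Finset.single_le_sum (f := fun i => (ts i).size) (fun _ _ => Nat.zero_le _)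
    (Finset.mem_univ i)
  simp only [size] at *
  omega

end Term

namespace Ctx

/-- Composition of contexts: `(C.comp D)[t] = C[D[t]]`. -/
def comp : Ctx ar V → Ctx ar V → Ctx ar V
  | hole, D => D
  | arg f i ts C, D => arg f i ts (C.comp D)

theorem fill_comp (C D : Ctx ar V) (t : Term ar V) : (C.comp D).fill t = C.fill (D.fill t) := by
  induction C with
  | hole => rfl
  | arg f i ts C ih => simp only [comp, fill, ih]

theorem subst_fill (σ : V → Term ar V) (C : Ctx ar V) (t : Term ar V) :
    (C.fill t).subst σ = (C.subst σ).fill (t.subst σ) := by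
  induction C with
  | hole => rfl
  | arg f i ts C ih =>
    simp only [fill, subst, Term.subst, ← ih, Term.app.injEq, heq_eq_eq, true_and]
    funext j
    by_cases h : j = i
    · subst h; simp
    · simp [h]

theorem subst_subst (σ τ : V → Term ar V) (C : Ctx ar V) :
    (C.subst σ).subst τ = C.subst fun x => (σ x).subst τ := by
  induction C with
  | hole => rfl
  | arg f i ts C ih => simp only [subst, ih, Term.subst_subst]

theorem size_fill_lt {C : Ctx ar V} (hC : C ≠ hole) (t : Term ar V) :
    t.size < (C.fill t).size := by
  induction C with
  | hole => exact absurd rfl hC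
  | arg f i ts C ih =>
    have h₁ : t.size ≤ (C.fill t).size := by
      by_cases h : C = hole
      · subst h; exact le_rfl
      · exact (ih h).le
    have h₂ := Term.size_arg_lt f (Function.update ts i (C.fill t)) i
    rw [Function.update_self] at h₂
    exact h₁.trans_lt h₂

theorem vars_subset_vars_fill (C : Ctx ar V) (t : Term ar V) : t.vars ⊆ (C.fill t).vars := by
  induction C with
  | hole => exact subset_rfl
  | arg f i ts C ih =>
    refine ih.trans fun x hx => Set.mem_iUnion.2 ⟨i, ?_⟩
    rwa [Function.update_self]

end Ctx

theorem Term.exists_fill_var {x : V} {t : Term ar V} (h : x ∈ t.vars) :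
    ∃ C : Ctx ar V, t = C.fill (.var x) := by
  induction t with
  | var y => exact ⟨.hole, by rw [Set.mem_singleton_iff.1 h]; rfl⟩
  | app f ts ih =>
    obtain ⟨i, hi⟩ := Set.mem_iUnion.1 h
    obtain ⟨C, hC⟩ := ih i hi
    exact ⟨.arg f i ts C, by simp only [Ctx.fill, ← hC, Function.update_eq_self]⟩

/-- If `C[x]` is linear, then changing the substitution at `x` changes the instance of `C[x]` only
at the hole. -/
theorem Term.IsLinear.subst_update [DecidableEq V] {x : V} {C : Ctx ar V}
    (h : (C.fill (.var x)).IsLinear) (σ : V → Term ar V) (v : Term ar V) :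
    (C.fill (.var x)).subst (Function.update σ x v) = (C.subst σ).fill v := by
  induction C with
  | hole => simp [Ctx.fill, Ctx.subst, Term.subst]
  | arg f i ts C ih =>
    obtain ⟨h₁, h₂⟩ := h
    simp only [Ctx.fill, Ctx.subst, Term.subst, Term.app.injEq, heq_eq_eq, true_and]
    funext j
    by_cases hj : j = i
    · subst hj
      have := h₁ j
      rw [Function.update_self] at this ⊢
      rw [ih this, Function.update_self]
    · rw [Function.update_of_ne hj, Function.update_of_ne hj]
      refine Term.subst_congr _ fun y hy => Function.update_of_ne ?_ _ _
      rintro rfl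
      have := h₂ i j (Ne.symm hj)
      rw [Function.update_self, Function.update_of_ne hj] at this
      exact Set.disjoint_left.1 this (C.vars_subset_vars_fill _ rfl) hy

/-- Two positions in a term are comparable or parallel. In the parallel case `G` is the term with
two holes. -/
theorem Ctx.fill_eq_fill_cases {C D : Ctx ar V} {a b : Term ar V} (h : C.fill a = D.fill b) :
    (∃ D' : Ctx ar V, b = D'.fill a ∧ ∀ x, C.fill x = D.fill (D'.fill x)) ∨
    (∃ C' : Ctx ar V, a = C'.fill b ∧ ∀ x, D.fill x = C.fill (C'.fill x)) ∨
    (∃ G : Term ar V → Term ar V → Term ar V,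
      (∀ x, C.fill x = G x b) ∧ (∀ y, D.fill y = G a y) ∧
      (∀ y, ∃ K : Ctx ar V, ∀ x, G x y = K.fill x) ∧
      (∀ x, ∃ K : Ctx ar V, ∀ y, G x y = K.fill y)) := by
  induction C generalizing D with
  | hole => exact .inr (.inl ⟨D, h, fun x => rfl⟩)
  | arg f i ts C ih =>
    cases D with
    | hole => exact .inl ⟨.arg f i ts C, h.symm, fun x => rfl⟩
    | arg g j us D =>
      simp only [fill, Term.app.injEq] at h
      obtain ⟨rfl, h⟩ := h
      have h := eq_of_heq h
      by_cases hij : i = j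
      · subst hij
        have hi : C.fill a = D.fill b := by simpa using congrFun h i
        have hu : ∀ t, Function.update us i t = Function.update ts i t := by
          intro t
          funext k
          by_cases hk : k = i
          · subst hk; simp
          · simpa [hk] using (congrFun h k).symm
        simp only [fill, hu]
        rcases ih hi with ⟨D', h₁, h₂⟩ | ⟨C', h₁, h₂⟩ | ⟨G, h₁, h₂, h₃, h₄⟩
        · exact .inl ⟨D', h₁, fun x => by rw [h₂]⟩
        · exact .inr (.inl ⟨C', h₁, fun x => by rw [h₂]⟩)
        · refine .inr (.inr ⟨fun x y => .app f (Function.update ts i (G x y)),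
            fun x => by rw [h₁], fun y => by rw [h₂], fun y => ?_, fun x => ?_⟩)
          · obtain ⟨K, hK⟩ := h₃ y
            exact ⟨.arg f i ts K, fun x => by simp only [hK, fill]⟩
          · obtain ⟨K, hK⟩ := h₄ x
            exact ⟨.arg f i ts K, fun y => by simp only [hK, fill]⟩
      · have hj : ts j = D.fill b := by simpa [Ne.symm hij] using congrFun h j
        have hu : ∀ y, Function.update us j y =
            Function.update (Function.update ts i (C.fill a)) j y := by
          intro y
          funext k
          by_cases hk : k = j
          · subst hk; simp
          · simpa [hk] using (congrFun h k).symm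
        refine .inr (.inr ⟨fun x y =>
          .app f (Function.update (Function.update ts i (C.fill x)) j (D.fill y)),
          fun x => ?_, fun y => ?_, fun y => ⟨.arg f i (Function.update ts j (D.fill y)) C, ?_⟩,
          fun x => ⟨.arg f j (Function.update ts i (C.fill x)) D, fun y => rfl⟩⟩)
        · simp only [fill]
          rw [Function.update_comm hij, ← hj, Function.update_eq_self]
        · simp only [fill, hu]
        · intro x
          simp only [fill]
          rw [Function.update_comm hij]

/-- A subterm of an instance `lσ` is either an instance of a non-variable subterm of `l`, or it
lies inside `σ x` for some occurrence of a variable `x` in `l`. -/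
theorem Term.subst_eq_fill_cases {l : Term ar V} {σ : V → Term ar V} {D : Ctx ar V}
    {a : Term ar V} (h : l.subst σ = D.fill a) :
    (∃ (C : Ctx ar V) (m : Term ar V), l = C.fill m ∧ ¬ m.IsVar ∧ m.subst σ = a ∧
      ∀ x, D.fill x = (C.subst σ).fill x) ∨
    (∃ (C : Ctx ar V) (x : V) (D' : Ctx ar V), l = C.fill (.var x) ∧ σ x = D'.fill a ∧
      ∀ y, D.fill y = (C.subst σ).fill (D'.fill y)) := by
  induction l generalizing D with
  | var x => exact .inr ⟨.hole, x, D, rfl, h, fun y => rfl⟩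
  | app f ts ih =>
    cases D with
    | hole => exact .inl ⟨.hole, .app f ts, rfl, (by rintro ⟨x, hx⟩; cases hx), h, fun x => rfl⟩
    | arg g j us D =>
      simp only [Ctx.fill, subst, Term.app.injEq] at h
      obtain ⟨rfl, h⟩ := h
      have h := eq_of_heq h
      have hj : (ts j).subst σ = D.fill a := by simpa using congrFun h j
      have hu : ∀ t, Function.update us j t = Function.update (fun i => (ts i).subst σ) j t := by
        intro t
        funext k
        by_cases hk : k = j
        · subst hk; simp
        · simpa [hk] using (congrFun h k).symm
      rcases ih j hj with ⟨C, m, h₁, h₂, h₃, h₄⟩ | ⟨C, x, D', h₁, h₂, h₃⟩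
      · refine .inl ⟨.arg f j ts C, m, ?_, h₂, h₃, fun x => ?_⟩
        · simp only [Ctx.fill, ← h₁, Function.update_eq_self]
        · simp only [Ctx.fill, Ctx.subst, hu, h₄]
      · refine .inr ⟨.arg f j ts C, x, D', ?_, h₂, fun y => ?_⟩
        · simp only [Ctx.fill, ← h₁, Function.update_eq_self]
        · simp only [Ctx.fill, Ctx.subst, hu, h₃]

theorem ProperSubterm.size_lt {s t : Term ar V} (h : ProperSubterm s t) : s.size < t.size := by
  obtain ⟨C, hC, rfl⟩ := h
  exact Ctx.size_fill_lt hC s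

theorem ProperSubterm.subst {s t : Term ar V} (h : ProperSubterm s t) (σ : V → Term ar V) :
    ProperSubterm (s.subst σ) (t.subst σ) := by
  obtain ⟨C, hC, rfl⟩ := h
  exact ⟨C.subst σ, by cases C <;> simp_all [Ctx.subst], Ctx.subst_fill σ C s⟩

/-! ### Rewrite relations -/

/-- Rewrite relations: relations on terms closed under contexts and substitutions. -/
structure IsRewriteRel (r : Term ar V → Term ar V → Prop) : Prop where
  ctx : ∀ (C : Ctx ar V) {s t}, r s t → r (C.fill s) (C.fill t)
  subst : ∀ (σ : V → Term ar V) {s t}, r s t → r (s.subst σ) (t.subst σ)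

namespace IsRewriteRel

variable {r : Term ar V → Term ar V → Prop}

theorem reflTransGen (h : IsRewriteRel r) : IsRewriteRel (Relation.ReflTransGen r) :=
  ⟨fun C _ _ hst => Relation.ReflTransGen.lift C.fill (fun _ _ => h.ctx C) _ _ hst,
    fun σ _ _ hst => Relation.ReflTransGen.lift (Term.subst σ) (fun _ _ => h.subst σ) _ _ hst⟩

theorem transGen (h : IsRewriteRel r) : IsRewriteRel (Relation.TransGen r) :=
  ⟨fun C _ _ hst => Relation.TransGen.lift C.fill (fun _ _ => h.ctx C) _ _ hst,
    fun σ _ _ hst => Relation.TransGen.lift (Term.subst σ) (fun _ _ => h.subst σ) _ _ hst⟩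

theorem modulo {q : Term ar V → Term ar V → Prop} (h : IsRewriteRel r) (hq : IsRewriteRel q) :
    IsRewriteRel (Modulo r q) := by
  refine ⟨fun C s t ⟨a, b, h₁, h₂, h₃⟩ => ⟨_, _, hq.ctx C h₁, h.ctx C h₂, hq.ctx C h₃⟩,
    fun σ s t ⟨a, b, h₁, h₂, h₃⟩ => ⟨_, _, hq.subst σ h₁, h.subst σ h₂, hq.subst σ h₃⟩⟩

theorem step_le (h : IsRewriteRel r) {E : Set (Term ar V × Term ar V)}
    (hE : ∀ s t, (s, t) ∈ E → r s t) {s t : Term ar V} (hst : Step E s t) : r s t := by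
  obtain ⟨l, r, hlr, C, σ, rfl, rfl⟩ := hst
  exact h.ctx C (h.subst σ (hE l r hlr))

/-- Rewriting inside the substitution. The arguments of a term are rewritten one by one. -/
theorem subst_reflTransGen (h : IsRewriteRel r) {σ τ : V → Term ar V}
    (hστ : ∀ x, Relation.ReflTransGen r (σ x) (τ x)) (t : Term ar V) :
    Relation.ReflTransGen r (t.subst σ) (t.subst τ) := by
  classical
  induction t with
  | var x => exact hστ x
  | app f ts ih =>
    have key : ∀ I : Finset (Fin (ar f)), Relation.ReflTransGen r
        (Term.app f fun i => (ts i).subst σ)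
        (Term.app f fun i => if i ∈ I then (ts i).subst τ else (ts i).subst σ) := by
      intro I
      induction I using Finset.induction_on with
      | empty => simpa using Relation.ReflTransGen.refl
      | insert a I ha ihI =>
        refine ihI.trans ?_
        have := h.reflTransGen.ctx (.arg f a
          (fun i => if i ∈ I then (ts i).subst τ else (ts i).subst σ) .hole) (ih a)
        simp only [Ctx.fill] at this
        convert this using 2 <;> funext i <;> by_cases hi : i = a <;>
          simp [hi, ha]
    simpa [Term.subst] using key Finset.univ

end IsRewriteRel

variable {E R B : Set (Term ar V × Term ar V)}

theorem isRewriteRel_step : IsRewriteRel (Step E) := by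
  refine ⟨fun C s t h => ?_, fun σ s t h => ?_⟩ <;> obtain ⟨l, r, hlr, D, τ, rfl, rfl⟩ := h
  · exact ⟨l, r, hlr, C.comp D, τ, (C.fill_comp D _).symm, (C.fill_comp D _).symm⟩
  · exact ⟨l, r, hlr, D.subst σ, fun x => (τ x).subst σ, by rw [Ctx.subst_fill, Term.subst_subst],
      by rw [Ctx.subst_fill, Term.subst_subst]⟩

theorem isRewriteRel_symStep : IsRewriteRel (SymStep E) :=
  ⟨fun C _ _ => Or.imp (isRewriteRel_step.ctx C) (isRewriteRel_step.ctx C),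
    fun σ _ _ => Or.imp (isRewriteRel_step.subst σ) (isRewriteRel_step.subst σ)⟩

theorem isRewriteRel_eqTheory : IsRewriteRel (EqTheory E) :=
  isRewriteRel_symStep.reflTransGen

theorem isRewriteRel_stepMod : IsRewriteRel (StepMod R B) :=
  isRewriteRel_step.modulo isRewriteRel_eqTheory

theorem step_of_mem {s t : Term ar V} (h : (s, t) ∈ E) : Step E s t :=
  ⟨s, t, h, .hole, .var, by simp [Ctx.fill, Term.subst_var], by simp [Ctx.fill, Term.subst_var]⟩

theorem Step.mono {E' : Set (Term ar V × Term ar V)} (h : E ⊆ E') {s t : Term ar V}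
    (hst : Step E s t) : Step E' s t :=
  isRewriteRel_step.step_le (fun _ _ hs => step_of_mem (h hs)) hst

theorem SymStep.symm {s t : Term ar V} (h : SymStep E s t) : SymStep E t s := Or.symm h

theorem SymStep.mono {E' : Set (Term ar V × Term ar V)} (h : E ⊆ E') {s t : Term ar V}
    (hst : SymStep E s t) : SymStep E' s t := hst.imp (Step.mono h) (Step.mono h)

theorem StepMod.mono {R' : Set (Term ar V × Term ar V)} (h : R ⊆ R') {s t : Term ar V}
    (hst : StepMod R B s t) : StepMod R' B s t := by
  obtain ⟨a, b, h₁, h₂, h₃⟩ := hst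
  exact ⟨a, b, h₁, h₂.mono h, h₃⟩

theorem EqTheory.refl (s : Term ar V) : EqTheory E s s := Relation.ReflTransGen.refl

theorem EqTheory.trans {s t w : Term ar V} (h₁ : EqTheory E s t) (h₂ : EqTheory E t w) :
    EqTheory E s w := Relation.ReflTransGen.trans h₁ h₂

theorem EqTheory.symm {s t : Term ar V} (h : EqTheory E s t) : EqTheory E t s := by
  induction h with
  | refl => exact .refl _
  | tail _ h₁ ih => exact .head h₁.symm ih

theorem EqTheory.of_symStep {s t : Term ar V} (h : SymStep E s t) : EqTheory E s t :=
  Relation.ReflTransGen.single h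

theorem EqTheory.of_step {s t : Term ar V} (h : Step E s t) : EqTheory E s t := .of_symStep (.inl h)

theorem EqTheory.mono {E' : Set (Term ar V × Term ar V)} (h : E ⊆ E') {s t : Term ar V}
    (hst : EqTheory E s t) : EqTheory E' s t :=
  Relation.ReflTransGen.mono (fun _ _ => SymStep.mono h) _ _ hst

/-- The equational theory of `E` is contained in every equational theory that satisfies `E`. -/
theorem EqTheory.le {E' : Set (Term ar V × Term ar V)}
    (h : ∀ s t, (s, t) ∈ E → EqTheory E' s t) {s t : Term ar V} (hst : EqTheory E s t) :
    EqTheory E' s t := by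
  induction hst with
  | refl => exact .refl _
  | tail _ h₁ ih =>
    rcases h₁ with h₁ | h₁
    · exact ih.trans (isRewriteRel_eqTheory.step_le h h₁)
    · exact ih.trans (isRewriteRel_eqTheory.step_le h h₁).symm

theorem Step.stepMod {s t : Term ar V} (h : Step R s t) : StepMod R B s t :=
  ⟨s, t, .refl s, h, .refl t⟩

/-- A reducible term has an innermost redex. -/
theorem exists_innermost_redex {t : Term ar V} (ht : ¬ IsNF R t) :
    ∃ (K : Ctx ar V) (l r : Term ar V) (σ : V → Term ar V), (l, r) ∈ R ∧
      t = K.fill (l.subst σ) ∧ ∀ v, ProperSubterm v (l.subst σ) → IsNF R v := by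
  induction hn : t.size using Nat.strong_induction_on generalizing t with
  | _ n ih =>
    subst hn
    simp only [IsNF, not_forall, not_not] at ht
    obtain ⟨u, l, r, hlr, C, σ, rfl, -⟩ := ht
    by_cases h : ∀ v, ProperSubterm v (l.subst σ) → IsNF R v
    · exact ⟨C, l, r, σ, hlr, rfl, h⟩
    · push Not at h
      obtain ⟨v, hv, hv'⟩ := h
      have hlt : v.size < (C.fill (l.subst σ)).size := by
        refine hv.size_lt.trans_le ?_
        by_cases hC : C = .hole
        · subst hC; exact le_rfl
        · exact (Ctx.size_fill_lt hC _).le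
      obtain ⟨K, l', r', σ', h₁, rfl, h₃⟩ := ih _ hlt hv' rfl
      obtain ⟨D, -, hD⟩ := hv
      refine ⟨C.comp (D.comp K), l', r', σ', h₁, ?_, h₃⟩
      rw [Ctx.fill_comp, Ctx.fill_comp, ← hD]

end Terms


section Unification

variable {F : Type u} {ar : F → ℕ} {V : Type v}

/-! ### Most general unifiers and critical peaks -/

theorem Term.size_subst_lt_of_mem_vars {x : V} {t : Term ar V} (hx : x ∈ t.vars)
    (ht : t ≠ .var x) (τ : V → Term ar V) : (τ x).size < (t.subst τ).size := by
  obtain ⟨C, rfl⟩ := Term.exists_fill_var hx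
  have hC : C ≠ .hole := by rintro rfl; exact ht rfl
  rw [Ctx.subst_fill]
  refine Ctx.size_fill_lt (t := τ x) ?_
  cases C
  · exact absurd rfl hC
  · simp [Ctx.subst]

/-- A unifiable list of equations has an idempotent most general unifier `σ`: every unifier `τ`
equals `σ` followed by `τ`. The induction is on the total size of the left-hand sides under a fixed
unifier, which decreases when an equation is decomposed and when a variable is eliminated. -/
theorem exists_mgu_list (τ : V → Term ar V) (L : List (Term ar V × Term ar V))
    (hL : ∀ e ∈ L, e.1.subst τ = e.2.subst τ) :
    ∃ σ : V → Term ar V, (∀ e ∈ L, e.1.subst σ = e.2.subst σ) ∧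
      ∀ τ' : V → Term ar V, (∀ e ∈ L, e.1.subst τ' = e.2.subst τ') →
        ∀ x, τ' x = (σ x).subst τ' := by
  classical
  induction hn : (L.map fun e => (e.1.subst τ).size).sum using Nat.strong_induction_on
    generalizing L with
  | _ n ih =>
    subst hn
    have elim : ∀ (x : V) (t : Term ar V) (L : List (Term ar V × Term ar V)) (N : ℕ),
        (∀ L' : List (Term ar V × Term ar V), (∀ e ∈ L', e.1.subst τ = e.2.subst τ) →
          (L'.map fun e => (e.1.subst τ).size).sum < N →
          ∃ σ : V → Term ar V, (∀ e ∈ L', e.1.subst σ = e.2.subst σ) ∧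
            ∀ τ' : V → Term ar V, (∀ e ∈ L', e.1.subst τ' = e.2.subst τ') →
              ∀ x, τ' x = (σ x).subst τ') →
        τ x = t.subst τ → (∀ e ∈ L, e.1.subst τ = e.2.subst τ) →
        (L.map fun e => (e.1.subst τ).size).sum < N →
        ∃ σ : V → Term ar V, σ x = t.subst σ ∧ (∀ e ∈ L, e.1.subst σ = e.2.subst σ) ∧
          ∀ τ' : V → Term ar V, τ' x = t.subst τ' → (∀ e ∈ L, e.1.subst τ' = e.2.subst τ') →
            ∀ x, τ' x = (σ x).subst τ' := by
      intro x t L N ih hx hL hN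
      by_cases ht : t = .var x
      · subst ht
        obtain ⟨σ, h₁, h₂⟩ := ih L hL hN
        exact ⟨σ, rfl, h₁, fun τ' _ => h₂ τ'⟩
      · have hxt : x ∉ t.vars := fun hxt =>
          absurd (Term.size_subst_lt_of_mem_vars hxt ht τ) (by rw [hx]; exact lt_irrefl _)
        -- the substitution that eliminates `x`
        let ρ : V → Term ar V := Function.update .var x t
        have hρ : ∀ τ' : V → Term ar V, τ' x = t.subst τ' → ∀ y, (ρ y).subst τ' = τ' y := by
          intro τ' h y
          by_cases hy : y = x
          · subst hy; simp [ρ, h]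
          · simp [ρ, hy, Term.subst]
        have hρ' : ∀ τ' : V → Term ar V, τ' x = t.subst τ' →
            ∀ s : Term ar V, (s.subst ρ).subst τ' = s.subst τ' := by
          intro τ' h s
          rw [Term.subst_subst]
          exact Term.subst_congr s fun y _ => hρ τ' h y
        have htρ : t.subst ρ = t := by
          conv_rhs => rw [← t.subst_var]
          exact Term.subst_congr t fun y hy =>
            Function.update_of_ne (by rintro rfl; exact hxt hy) _ _
        obtain ⟨σ, h₁, h₂⟩ := ih (L.map fun e => (e.1.subst ρ, e.2.subst ρ))
          (by
            simp only [List.mem_map, forall_exists_index, and_imp, forall_apply_eq_imp_iff₂]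
            intro e he
            rw [hρ' τ hx, hρ' τ hx, hL e he])
          (by simpa [List.map_map, Function.comp_def, hρ' τ hx] using hN)
        refine ⟨fun y => (ρ y).subst σ, ?_, fun e he => ?_, fun τ' hx' hL' y => ?_⟩
        · simp only
          rw [← Term.subst_subst, htρ]
          simp [ρ]
        · rw [← Term.subst_subst, ← Term.subst_subst]
          exact h₁ _ (List.mem_map.2 ⟨e, he, rfl⟩)
        · have := h₂ τ' (by
            simp only [List.mem_map, forall_exists_index, and_imp, forall_apply_eq_imp_iff₂]
            intro e he
            rw [hρ' τ' hx', hρ' τ' hx', hL' e he])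
          rw [Term.subst_subst, ← hρ τ' hx' y]
          exact Term.subst_congr _ fun z _ => this z
    cases L with
    | nil => exact ⟨.var, by simp, fun τ' _ x => rfl⟩
    | cons e L =>
      obtain ⟨s, t⟩ := e
      simp only [List.forall_mem_cons] at hL ⊢
      obtain ⟨hst, hL⟩ := hL
      have hlt : (L.map fun e => (e.1.subst τ).size).sum <
          (((s, t) :: L).map fun e => (e.1.subst τ).size).sum := by
        have := (s.subst τ).size_pos
        simp only [List.map_cons, List.sum_cons]
        omega
      have ih' := fun L' hL' hlt => ih _ hlt L' hL' rfl
      cases s with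
      | var x =>
        obtain ⟨σ, h₁, h₂, h₃⟩ := elim x t L _ ih' hst hL hlt
        exact ⟨σ, ⟨h₁, h₂⟩, fun τ' h => h₃ τ' h.1 h.2⟩
      | app f ts =>
        cases t with
        | var x =>
          obtain ⟨σ, h₁, h₂, h₃⟩ := elim x (.app f ts) L _ ih' hst.symm hL hlt
          exact ⟨σ, ⟨h₁.symm, h₂⟩, fun τ' h => h₃ τ' h.1.symm h.2⟩
        | app g us =>
          simp only [Term.subst, Term.app.injEq] at hst
          obtain ⟨rfl, hst⟩ := hst
          have hst := congrFun (eq_of_heq hst)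
          have hmem : ∀ θ : V → Term ar V,
              (∀ e ∈ List.ofFn (fun i => (ts i, us i)) ++ L, e.1.subst θ = e.2.subst θ) ↔
              (∀ i, (ts i).subst θ = (us i).subst θ) ∧ ∀ e ∈ L, e.1.subst θ = e.2.subst θ := by
            intro θ
            simp only [List.mem_append, List.mem_ofFn, or_imp, forall_and, forall_exists_index,
              forall_apply_eq_imp_iff]
          have happ : ∀ θ : V → Term ar V,
              (Term.app f ts).subst θ = (Term.app f us).subst θ ↔
                ∀ i, (ts i).subst θ = (us i).subst θ := by
            intro θ
            simp only [Term.subst, Term.app.injEq, heq_eq_eq, true_and, funext_iff]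
          obtain ⟨σ, h₁, h₂⟩ := ih' (List.ofFn (fun i => (ts i, us i)) ++ L)
            ((hmem τ).2 ⟨hst, hL⟩) (by
              simp only [List.map_append, List.map_ofFn, List.sum_append, List.sum_ofFn,
                List.map_cons, List.sum_cons, Function.comp_def, Term.subst, Term.size]
              omega)
          exact ⟨σ, ⟨(happ σ).2 ((hmem σ).1 h₁).1, ((hmem σ).1 h₁).2⟩,
            fun τ' h => h₂ τ' ((hmem τ').2 ⟨(happ τ').1 h.1, h.2⟩)⟩

theorem exists_idempotent_mgu {s t : Term ar V} {τ : V → Term ar V}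
    (h : s.subst τ = t.subst τ) :
    ∃ σ : V → Term ar V, IsMGU σ s t ∧ ∀ x, τ x = (σ x).subst τ := by
  obtain ⟨σ, h₁, h₂⟩ := exists_mgu_list τ [(s, t)] (by simpa using h)
  exact ⟨σ, ⟨by simpa using h₁, fun τ' h' => ⟨τ', h₂ τ' (by simpa using h')⟩⟩,
    h₂ τ (by simpa using h)⟩

/-- Finitely many variables can be renamed away from a finite set. -/
theorem exists_perm_image_disjoint [Infinite V] {S T : Set V} (hS : S.Finite) (hT : T.Finite) :
    ∃ π : Equiv.Perm V, Disjoint (π '' S) T := by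
  classical
  induction S, hS using Set.Finite.induction_on with
  | empty => exact ⟨1, by simp⟩
  | @insert a S ha hS ih =>
    obtain ⟨π, hπ⟩ := ih
    obtain ⟨b, hb⟩ := (hT.union (hS.image π)).exists_notMem
    refine ⟨π.trans (Equiv.swap (π a) b), ?_⟩
    rw [Set.disjoint_left] at hπ ⊢
    rintro _ ⟨x, hx | hx, rfl⟩
    · subst hx
      simpa using fun h => hb (.inl h)
    · have h₁ : π x ≠ π a := fun h => ha (π.injective h ▸ hx)
      have h₂ : π x ≠ b := fun h => hb (.inr ⟨x, hx, h⟩)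
      simpa [Equiv.swap_apply_of_ne_of_ne h₁ h₂] using hπ ⟨x, hx, rfl⟩

theorem Ctx.subst_fill_congr {σ τ : V → Term ar V} (C : Ctx ar V) (m a : Term ar V)
    (h : ∀ x ∈ (C.fill m).vars, σ x = τ x) : (C.subst σ).fill a = (C.subst τ).fill a := by
  induction C with
  | hole => rfl
  | arg f i ts C ih =>
    have hv : ∀ j, (Function.update ts i (C.fill m) j).vars ⊆ (Ctx.fill (.arg f i ts C) m).vars :=
      fun j x hx => Set.mem_iUnion.2 ⟨j, hx⟩
    simp only [fill, subst, Term.app.injEq, heq_eq_eq, true_and]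
    funext j
    by_cases hj : j = i
    · subst hj
      simp only [Function.update_self]
      exact ih fun x hx => h x (hv j (by rwa [Function.update_self]))
    · simp only [Function.update_of_ne hj]
      exact Term.subst_congr _ fun x hx => h x (hv j (by rwa [Function.update_of_ne hj]))

/-- Every overlap of two rule instances at a non-variable position is an instance of a critical
peak. -/
theorem exists_criticalPeak [Infinite V] {R₁ R₂ : Set (Term ar V × Term ar V)}
    {l₁ r₁ r₂ m : Term ar V} {C : Ctx ar V} {σ₁ σ₂ : V → Term ar V}
    (h₁ : (l₁, r₁) ∈ R₁) (h₂ : (C.fill m, r₂) ∈ R₂) (hm : ¬ m.IsVar)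
    (h : l₁.subst σ₁ = m.subst σ₂)
    (hvar : C = .hole → ¬ IsVariant (l₁, r₁) (C.fill m, r₂)) :
    ∃ (t w s u : Term ar V) (δ : V → Term ar V), CriticalPeak R₁ R₂ t w s u ∧
      t.subst δ = (C.subst σ₂).fill (r₁.subst σ₁) ∧ w.subst δ = l₁.subst σ₁ ∧
      s.subst δ = (C.fill m).subst σ₂ ∧ u.subst δ = r₂.subst σ₂ := by
  classical
  obtain ⟨π, hπ⟩ := exists_perm_image_disjoint (l₁.finite_vars.union r₁.finite_vars)
    ((C.fill m).finite_vars.union r₂.finite_vars)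
  have hdisj := hπ
  rw [Set.disjoint_left] at hπ
  let τ : V → Term ar V := fun x => if x ∈ (C.fill m).vars ∪ r₂.vars then σ₂ x else σ₁ (π.symm x)
  have hτ₁ : ∀ t : Term ar V, t.vars ⊆ l₁.vars ∪ r₁.vars → (t.rename π).subst τ = t.subst σ₁ := by
    intro t ht
    rw [Term.subst_rename]
    refine Term.subst_congr t fun x hx => ?_
    simp only [τ, if_neg (hπ ⟨x, ht hx, rfl⟩), Equiv.symm_apply_apply]
  have hτ₂ : ∀ t : Term ar V, t.vars ⊆ (C.fill m).vars ∪ r₂.vars → t.subst τ = t.subst σ₂ :=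
    fun t ht => Term.subst_congr t fun x hx => if_pos (ht hx)
  have hl₁ := hτ₁ l₁ Set.subset_union_left
  have hr₁ := hτ₁ r₁ Set.subset_union_right
  have hl₂ := hτ₂ (C.fill m) Set.subset_union_left
  have hr₂ := hτ₂ r₂ Set.subset_union_right
  have hm' := hτ₂ m ((C.vars_subset_vars_fill m).trans Set.subset_union_left)
  obtain ⟨μ, hμ, hμτ⟩ := exists_idempotent_mgu (hl₁.trans (h.trans hm'.symm))
  have hcomp : ∀ t : Term ar V, (t.subst μ).subst τ = t.subst τ := fun t => by
    rw [Term.subst_subst]; exact Term.subst_congr t fun x _ => (hμτ x).symm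
  have hC : (C.subst μ).subst τ = C.subst τ := by
    rw [Ctx.subst_subst]; congr; funext x; exact (hμτ x).symm
  refine ⟨(C.subst μ).fill ((r₁.rename π).subst μ), (l₁.rename π).subst μ, (C.fill m).subst μ,
    r₂.subst μ, τ, ⟨l₁.rename π, r₁.rename π, C.fill m, r₂, ⟨_, h₁, π, rfl, rfl⟩,
      ⟨_, h₂, 1, Term.subst_var _, Term.subst_var _⟩, ?_, C, m, μ, rfl, hm, hμ, ?_, rfl, rfl, rfl,
      rfl⟩, ?_, ?_, ?_, ?_⟩
  · rwa [Term.vars_rename, Term.vars_rename, ← Set.image_union]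
  · rintro hC ⟨ρ, hρ₁, hρ₂⟩
    refine hvar hC ⟨π.trans ρ, ?_, ?_⟩
    · simpa only [Term.rename, Term.subst_subst, Term.subst, Equiv.trans_apply] using hρ₁
    · simpa only [Term.rename, Term.subst_subst, Term.subst, Equiv.trans_apply] using hρ₂
  · rw [Ctx.subst_fill, hcomp, hr₁, hC]
    exact C.subst_fill_congr m _ fun x hx => if_pos (.inl hx)
  · rw [hcomp, hl₁]
  · rw [hcomp, hl₂]
  · rw [hcomp, hr₂]

end Unification


section Order

variable {F : Type u} {ar : F → ℕ} {V : Type v} {B R S : Set (Term ar V × Term ar V)}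
  {gt : Term ar V → Term ar V → Prop}

/-! ### Reduction orders -/

namespace IsReductionOrder

theorem wellFounded (hgt : IsReductionOrder B gt) : WellFounded fun a b => gt b a := by
  rw [wellFounded_iff_isEmpty_descending_chain]
  exact ⟨fun ⟨f, hf⟩ => hgt.wf ⟨f, hf⟩⟩

theorem irrefl (hgt : IsReductionOrder B gt) (s : Term ar V) : ¬ gt s s :=
  fun h => hgt.wf ⟨fun _ => s, fun _ => h⟩

theorem trans_eqTheory (hgt : IsReductionOrder B gt) {s t u : Term ar V} (h : gt s t)
    (h' : EqTheory B t u) : gt s u :=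
  hgt.compat s s t u (.refl s) h h'

theorem eqTheory_trans (hgt : IsReductionOrder B gt) {s t u : Term ar V} (h : EqTheory B s t)
    (h' : gt t u) : gt s u :=
  hgt.compat s t u u h h' (.refl u)

theorem isRewriteRel (hgt : IsReductionOrder B gt) : IsRewriteRel gt :=
  ⟨fun C _ _ => hgt.ctx C _ _, fun σ _ _ => hgt.subst σ _ _⟩

theorem gt_of_step (hgt : IsReductionOrder B gt) (hR : ∀ l r, (l, r) ∈ R → gt l r)
    {s t : Term ar V} (h : Step R s t) : gt s t :=
  hgt.isRewriteRel.step_le hR h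

theorem gt_of_stepMod (hgt : IsReductionOrder B gt) (hR : ∀ l r, (l, r) ∈ R → gt l r)
    {s t : Term ar V} (h : StepMod R B s t) : gt s t := by
  obtain ⟨a, b, h₁, h₂, h₃⟩ := h
  exact hgt.compat _ _ _ _ h₁ (hgt.gt_of_step hR h₂) h₃

theorem gt_of_transGen_stepMod (hgt : IsReductionOrder B gt) (hR : ∀ l r, (l, r) ∈ R → gt l r)
    {s t : Term ar V} (h : Relation.TransGen (StepMod R B) s t) : gt s t := by
  induction h with
  | single h => exact hgt.gt_of_stepMod hR h
  | tail _ h ih => exact hgt.trans _ _ _ ih (hgt.gt_of_stepMod hR h)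

theorem not_gt_fill (hgt : IsReductionOrder B gt) (C : Ctx ar V) (t : Term ar V) :
    ¬ gt t (C.fill t) := by
  intro h
  refine hgt.wf ⟨fun n => C.fill^[n] t, fun n => ?_⟩
  induction n with
  | zero => exact h
  | succ n ih =>
    simp only [Function.iterate_succ_apply'] at ih ⊢
    exact hgt.ctx C _ _ ih

theorem vars_subset (hgt : IsReductionOrder B gt) {s t : Term ar V} (h : gt s t) :
    t.vars ⊆ s.vars := by
  classical
  intro y hy
  by_contra hys
  obtain ⟨C, rfl⟩ := Term.exists_fill_var hy
  -- instantiating `y` by `s` yields `s > C'[s]`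
  have := hgt.subst (Function.update .var y s) _ _ h
  rw [Ctx.subst_fill, Term.subst, Function.update_self,
    Term.subst_congr (τ := .var) s fun x hx =>
      Function.update_of_ne (by rintro rfl; exact hys hx) _ _, Term.subst_var] at this
  exact hgt.not_gt_fill _ _ this

theorem not_isVar (hgt : IsReductionOrder B gt) {s t : Term ar V} (h : gt s t) : ¬ s.IsVar := by
  rintro ⟨x, rfl⟩
  by_cases hx : x ∈ t.vars
  · obtain ⟨C, rfl⟩ := Term.exists_fill_var hx
    exact hgt.not_gt_fill _ _ h
  · have := hgt.subst (fun _ => t) _ _ h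
    rw [Term.subst_congr (τ := .var) t fun y hy => absurd (hgt.vars_subset h hy)
      (by rintro rfl; exact hx hy), Term.subst_var] at this
    exact hgt.irrefl _ this

theorem isTRS (hgt : IsReductionOrder B gt) (hR : ∀ l r, (l, r) ∈ R → gt l r) : IsTRS R :=
  fun l r h => ⟨hgt.not_isVar (hR l r h), hgt.vars_subset (hR l r h)⟩

theorem exists_nf (hgt : IsReductionOrder B gt) (hR : ∀ l r, (l, r) ∈ R → gt l r)
    (t : Term ar V) : ∃ n, Relation.ReflTransGen (Step R) t n ∧ IsNF R n := by
  induction t using hgt.wellFounded.induction with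
  | _ t ih =>
    by_cases h : IsNF R t
    · exact ⟨t, .refl, h⟩
    · simp only [IsNF, not_forall, not_not] at h
      obtain ⟨u, hu⟩ := h
      obtain ⟨n, h₁, h₂⟩ := ih u (hgt.gt_of_step hR hu)
      exact ⟨n, .head hu h₁, h₂⟩

end IsReductionOrder

theorem isNF_of_reflTransGen_eq {s t : Term ar V} (hs : IsNF R s)
    (h : Relation.ReflTransGen (Step R) s t) : t = s := by
  rcases h.cases_head with h | ⟨u, hu, -⟩
  · exact h.symm
  · exact absurd hu (hs u)

/-! ### Conversions below a term -/

/-- Conversion in `S` through terms below `m`. -/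
def ConvBelow (gt : Term ar V → Term ar V → Prop) (S : Set (Term ar V × Term ar V))
    (m : Term ar V) : Term ar V → Term ar V → Prop :=
  Relation.ReflTransGen fun a b => gt m a ∧ gt m b ∧ SymStep S a b

namespace ConvBelow

theorem refl (m s : Term ar V) : ConvBelow gt S m s s := Relation.ReflTransGen.refl

theorem trans {m s t u : Term ar V} (h₁ : ConvBelow gt S m s t) (h₂ : ConvBelow gt S m t u) :
    ConvBelow gt S m s u := Relation.ReflTransGen.trans h₁ h₂

theorem symm {m s t : Term ar V} (h : ConvBelow gt S m s t) : ConvBelow gt S m t s := by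
  induction h with
  | refl => exact .refl _ _
  | tail _ h ih => exact .head ⟨h.2.1, h.1, h.2.2.symm⟩ ih

theorem single {m s t : Term ar V} (h₁ : gt m s) (h₂ : gt m t) (h : SymStep S s t) :
    ConvBelow gt S m s t := Relation.ReflTransGen.single ⟨h₁, h₂, h⟩

theorem le {S' : Set (Term ar V × Term ar V)} {m m' s t : Term ar V}
    (hm : ∀ a, gt m a → gt m' a)
    (hS : ∀ a b, gt m' a → gt m' b → Step S a b → ConvBelow gt S' m' a b)
    (h : ConvBelow gt S m s t) : ConvBelow gt S' m' s t := by
  induction h with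
  | refl => exact .refl _ _
  | tail _ h ih =>
    obtain ⟨h₁, h₂, h | h⟩ := h
    · exact ih.trans (hS _ _ (hm _ h₁) (hm _ h₂) h)
    · exact ih.trans (hS _ _ (hm _ h₂) (hm _ h₁) h).symm

theorem mono_right {m m' s t : Term ar V} (hm : ∀ a, gt m a → gt m' a)
    (h : ConvBelow gt S m s t) : ConvBelow gt S m' s t :=
  h.le hm fun _ _ h₁ h₂ h => single h₁ h₂ (.inl h)

theorem map {m s t : Term ar V} {f : Term ar V → Term ar V}
    (hgt : ∀ a b, gt a b → gt (f a) (f b)) (hS : ∀ a b, SymStep S a b → SymStep S (f a) (f b))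
    (h : ConvBelow gt S m s t) : ConvBelow gt S (f m) (f s) (f t) :=
  Relation.ReflTransGen.lift f (fun _ _ h => ⟨hgt _ _ h.1, hgt _ _ h.2.1, hS _ _ h.2.2⟩) _ _ h

theorem ctx (hgt : IsReductionOrder B gt) (C : Ctx ar V) {m s t : Term ar V}
    (h : ConvBelow gt S m s t) : ConvBelow gt S (C.fill m) (C.fill s) (C.fill t) :=
  h.map (hgt.ctx C) fun _ _ => isRewriteRel_symStep.ctx C

theorem subst (hgt : IsReductionOrder B gt) (σ : V → Term ar V) {m s t : Term ar V}
    (h : ConvBelow gt S m s t) : ConvBelow gt S (m.subst σ) (s.subst σ) (t.subst σ) :=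
  h.map (hgt.subst σ) fun _ _ => isRewriteRel_symStep.subst σ

theorem of_eqTheory (hgt : IsReductionOrder B gt) (hS : B ⊆ S) {m s t : Term ar V}
    (hm : gt m s) (h : EqTheory B s t) : ConvBelow gt S m s t := by
  induction h with
  | refl => exact .refl _ _
  | tail h₁ h₂ ih =>
    exact ih.trans (single (hgt.trans_eqTheory hm h₁)
      (hgt.trans_eqTheory hm (h₁.tail h₂)) (SymStep.mono hS h₂))

theorem of_steps (hgt : IsReductionOrder B gt) (hR : ∀ l r, (l, r) ∈ R → gt l r) (hS : R ⊆ S)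
    {m s t : Term ar V} (hm : gt m s) (h : Relation.ReflTransGen (Step R) s t) :
    ConvBelow gt S m s t ∧ gt m t := by
  induction h with
  | refl => exact ⟨.refl _ _, hm⟩
  | tail h₁ h₂ ih =>
    have := hgt.trans _ _ _ ih.2 (hgt.gt_of_step hR h₂)
    exact ⟨ih.1.trans (single ih.2 this (.inl (h₂.mono hS))), this⟩

theorem of_stepMod (hgt : IsReductionOrder B gt) (hR : ∀ l r, (l, r) ∈ R → gt l r) (hRS : R ⊆ S)
    (hBS : B ⊆ S) {m s t : Term ar V} (hm : gt m s) (h : StepMod R B s t) :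
    ConvBelow gt S m s t := by
  obtain ⟨a, b, h₁, h₂, h₃⟩ := h
  have ha := hgt.trans_eqTheory hm h₁
  have hb := hgt.trans _ _ _ ha (hgt.gt_of_step hR h₂)
  exact ((of_eqTheory hgt hBS hm h₁).trans (single ha hb (.inl (h₂.mono hRS)))).trans
    (of_eqTheory hgt hBS hb h₃)

end ConvBelow

/-- Local criterion for the Church–Rosser property modulo `B`: every local peak has a conversion
below its source, and in every local cliff `s ← m ↔ t` the term `t` has a reduct that is connected
to `s` below `m`. By well-founded induction, `B`-equivalent terms have `B`-equivalent normal
forms. -/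
theorem churchRosserModulo_of_peaks_of_cliffs (hgt : IsReductionOrder B gt)
    (hR : ∀ l r, (l, r) ∈ R → gt l r)
    (peak : ∀ s m t, Step R m s → Step R m t → ConvBelow gt (R ∪ B) m s t)
    (cliff : ∀ s m t, Step R m s → SymStep B m t →
      ∃ c, Step R t c ∧ ConvBelow gt (R ∪ B) m c s) :
    ChurchRosserModulo (Step R) (EqTheory B) := by
  have nf : ∀ m m', EqTheory B m m' → ∀ n n', Relation.ReflTransGen (Step R) m n → IsNF R n →
      Relation.ReflTransGen (Step R) m' n' → IsNF R n' → EqTheory B n n' := by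
    intro m
    induction m using hgt.wellFounded.induction with
    | _ m ih =>
      -- terms connected below `m` have equivalent normal forms
      have below : ∀ x y, gt m x → ConvBelow gt (R ∪ B) m x y → ∀ n n',
          Relation.ReflTransGen (Step R) x n → IsNF R n →
          Relation.ReflTransGen (Step R) y n' → IsNF R n' → EqTheory B n n' := by
        intro x y hx hxy n n' hn hn' hy hy'
        induction hxy generalizing n' with
        | refl => exact ih x hx x (.refl x) n n' hn hn' hy hy'
        | @tail y z _ hyz ihy =>
          obtain ⟨h₁, h₂, h⟩ := hyz
          obtain ⟨k, hk, hk'⟩ := hgt.exists_nf hR y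
          rcases h with ⟨l, r, hlr | hlr, h⟩ | ⟨l, r, hlr | hlr, h⟩
          · exact ihy n' (.head ⟨l, r, hlr, h⟩ hy) hy'
          · exact (ihy k hk hk').trans
              (ih y h₁ z (.of_step ⟨l, r, hlr, h⟩) k n' hk hk' hy hy')
          · exact (ihy k hk hk').trans
              (ih z h₂ z (.refl z) k n' (.head ⟨l, r, hlr, h⟩ hk) hk' hy hy')
          · exact (ihy k hk hk').trans
              (ih z h₂ y (.of_step ⟨l, r, hlr, h⟩) n' k hy hy' hk hk').symm
      have same : ∀ m₀, EqTheory B m m₀ → ∀ n n', Relation.ReflTransGen (Step R) m₀ n →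
          IsNF R n → Relation.ReflTransGen (Step R) m₀ n' → IsNF R n' → EqTheory B n n' := by
        intro m₀ hm₀ n n' hn hn' hk hk'
        rcases hn.cases_head with rfl | ⟨x, hx, hxn⟩
        · rw [isNF_of_reflTransGen_eq hn' hk]; exact .refl _
        rcases hk.cases_head with rfl | ⟨y, hy, hyn⟩
        · exact absurd hx (hk' x)
        exact below x y (hgt.eqTheory_trans hm₀ (hgt.gt_of_step hR hx))
          ((peak _ _ _ hx hy).mono_right fun a => hgt.eqTheory_trans hm₀) n n' hxn hn' hyn hk'
      -- one cliff `x ← m₁ ↔ m₂`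
      have step : ∀ m₁ m₂, EqTheory B m m₁ → SymStep B m₁ m₂ → ¬ IsNF R m₁ → ∀ n n',
          Relation.ReflTransGen (Step R) m₁ n → IsNF R n →
          Relation.ReflTransGen (Step R) m₂ n' → IsNF R n' → EqTheory B n n' := by
        intro m₁ m₂ hm₁ h₁₂ hred n n' hn hn' hk hk'
        simp only [IsNF, not_forall, not_not] at hred
        obtain ⟨x, hx⟩ := hred
        obtain ⟨c, hc, hcx⟩ := cliff _ _ _ hx h₁₂
        obtain ⟨p, hp, hp'⟩ := hgt.exists_nf hR x
        obtain ⟨q, hq, hq'⟩ := hgt.exists_nf hR c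
        have hm₂ := hm₁.trans (.of_symStep h₁₂)
        exact (same m₁ hm₁ n p hn hn' (.head hx hp) hp').trans
          ((below c x (hgt.eqTheory_trans hm₂ (hgt.gt_of_step hR hc))
            (hcx.mono_right fun a => hgt.eqTheory_trans hm₁) q p hq hq' hp hp').symm.trans
          (same m₂ hm₂ q n' (.head hc hq) hq' hk hk'))
      intro m' hm' n n' hn hn' hk hk'
      induction hm' generalizing n' with
      | refl => exact same m (.refl m) n n' hn hn' hk hk'
      | @tail m₁ m₂ h₁ h₂ ihm =>
        obtain ⟨p, hp, hp'⟩ := hgt.exists_nf hR m₁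
        refine (ihm p hp hp').trans ?_
        by_cases hm₁ : IsNF R m₁
        · by_cases hm₂ : IsNF R m₂
          · rw [isNF_of_reflTransGen_eq hm₁ hp, isNF_of_reflTransGen_eq hm₂ hk]
            exact .of_symStep h₂
          · exact (step m₂ m₁ (.trans h₁ (.of_symStep h₂)) h₂.symm hm₂ n' p hk hk' hp hp').symm
        · exact step m₁ m₂ h₁ h₂ hm₁ p n' hp hp' hk hk'
  intro a b hab
  obtain ⟨n, hn, hn'⟩ := hgt.exists_nf hR a
  obtain ⟨k, hk, hk'⟩ := hgt.exists_nf hR b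
  refine ⟨n, k, hn, ?_, hk⟩
  induction hab generalizing k with
  | refl => exact nf a a (.refl a) n k hn hn' hk hk'
  | @tail b c _ h ih =>
    obtain ⟨p, hp, hp'⟩ := hgt.exists_nf hR b
    rcases h with h | h | h
    · exact ih k (.head h hk) hk'
    · exact (ih p hp hp').trans (nf c c (.refl c) p k (.head h hp) hp' hk hk')
    · exact (ih p hp hp').trans (nf b c h p k hp hp' hk hk')

end Order


section LocalAnalysis

variable {F : Type u} {ar : F → ℕ} {V : Type v} {B R S : Set (Term ar V × Term ar V)}
  {gt : Term ar V → Term ar V → Prop}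

/-! ### Local peaks and cliffs -/

theorem Term.eq_of_subst_eq {σ τ : V → Term ar V} {t : Term ar V}
    (h : t.subst σ = t.subst τ) : ∀ x ∈ t.vars, σ x = τ x := by
  induction t with
  | var y => rintro x rfl; exact h
  | app f ts ih =>
    intro x hx
    obtain ⟨i, hi⟩ := Set.mem_iUnion.1 hx
    simp only [subst, app.injEq, heq_eq_eq, true_and] at h
    exact ih i (congrFun h i) x hi

theorem IsNF.of_subst {t : Term ar V} {σ : V → Term ar V} (h : IsNF R (t.subst σ)) : IsNF R t :=
  fun _ hu => h _ (isRewriteRel_step.subst σ hu)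

/-- Primality passes from an instance to the critical peak. -/
theorem isNF_of_properSubterm_subst {w : Term ar V} {δ : V → Term ar V} {a : Term ar V}
    (hw : w.subst δ = a) (ha : ∀ v, ProperSubterm v a → IsNF R v) :
    ∀ v, ProperSubterm v w → IsNF R v :=
  fun _ hv => (ha _ (hw ▸ hv.subst δ)).of_subst

theorem step_symmEqs_iff {s t : Term ar V} : Step (symmEqs B) s t ↔ SymStep B s t := by
  constructor
  · rintro ⟨l, r, h | h, C, σ, rfl, rfl⟩
    · exact .inl ⟨l, r, h, C, σ, rfl, rfl⟩
    · exact .inr ⟨r, l, h, C, σ, rfl, rfl⟩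
  · rintro (⟨l, r, h, C, σ, rfl, rfl⟩ | ⟨l, r, h, C, σ, rfl, rfl⟩)
    · exact ⟨l, r, .inl h, C, σ, rfl, rfl⟩
    · exact ⟨r, l, .inr h, C, σ, rfl, rfl⟩

theorem eqTheory_of_mem_symmEqs {l r : Term ar V} (h : (l, r) ∈ symmEqs B) : EqTheory B l r :=
  .of_symStep (step_symmEqs_iff.1 (step_of_mem h))

/-- Conditions on a left-linear system `R` and linear, variable-preserving equations `B` under
which `R` is Church–Rosser modulo `B`: prime critical peaks of `R` and prime critical peaks between
`R` and `B` are connected below their sources as in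
`churchRosserModulo_of_peaks_of_cliffs`. -/
structure PrimeCriticalConditions (gt : Term ar V → Term ar V → Prop)
    (R B : Set (Term ar V × Term ar V)) : Prop where
  order : IsReductionOrder B gt
  oriented : ∀ l r, (l, r) ∈ R → gt l r
  leftLinear : LeftLinear R
  linear : ∀ l r, (l, r) ∈ symmEqs B → l.IsLinear ∧ l.vars ⊆ r.vars
  peak : ∀ t w s u, CriticalPeak R R t w s u → (∀ v, ProperSubterm v w → IsNF R v) →
    ConvBelow gt (R ∪ B) s t u
  cliff : ∀ t w s u, CriticalPeak R (symmEqs B) t w s u →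
    (∀ v, ProperSubterm v w → IsNF R v) → ∃ c, Step R u c ∧ ConvBelow gt (R ∪ B) s c t
  cliff' : ∀ t w s u, CriticalPeak (symmEqs B) R t w s u →
    (∀ v, ProperSubterm v w → IsNF R v) → ∃ c, Step R t c ∧ ConvBelow gt (R ∪ B) s c u

namespace PrimeCriticalConditions

variable [Infinite V]

/-- A peak in which the inner redex is innermost and lies below the outer redex. -/
theorem peak_of_prime (H : PrimeCriticalConditions gt R B)
    {l₁ r₁ l₂ r₂ : Term ar V} {σ₁ σ₂ : V → Term ar V} {D : Ctx ar V}
    (h₁ : (l₁, r₁) ∈ R) (h₂ : (l₂, r₂) ∈ R) (h : l₂.subst σ₂ = D.fill (l₁.subst σ₁))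
    (hp : ∀ v, ProperSubterm v (l₁.subst σ₁) → IsNF R v) :
    ConvBelow gt (R ∪ B) (l₂.subst σ₂) (D.fill (r₁.subst σ₁)) (r₂.subst σ₂) := by
  classical
  have hgt := H.order
  rcases Term.subst_eq_fill_cases h with ⟨C, m, rfl, hm, hma, hD⟩ | ⟨C, x, D', rfl, hx, hD⟩
  · by_cases hvar : C = .hole ∧ IsVariant (l₁, r₁) (C.fill m, r₂)
    · -- the two steps coincide
      obtain ⟨rfl, π, hπ₁, hπ₂⟩ := hvar
      simp only [Ctx.fill, Ctx.subst] at hπ₁ hπ₂ hD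
      have h₃ : l₁.subst (fun x => σ₂ (π x)) = l₁.subst σ₁ := by
        rw [← Term.subst_rename, hπ₁, hma]
      have h₄ : r₂.subst σ₂ = r₁.subst σ₁ := by
        rw [← hπ₂, Term.subst_rename]
        exact Term.subst_congr _ fun x hx =>
          Term.eq_of_subst_eq h₃ x (hgt.vars_subset (H.oriented _ _ h₁) hx)
      rw [hD, h₄]
      exact .refl _ _
    · obtain ⟨t, w, s, u, δ, hcp, ht, hw, hs, hu⟩ := exists_criticalPeak h₁ h₂ hm hma.symm
        fun hC hv => hvar ⟨hC, hv⟩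
      have := (H.peak t w s u hcp (isNF_of_properSubterm_subst hw hp)).subst hgt δ
      rwa [ht, hs, hu, ← hD] at this
  · -- the inner redex lies in the substitution
    have hl := (H.leftLinear _ _ h₂).subst_update σ₂ (D'.fill (r₁.subst σ₁))
    rw [← hD] at hl
    have hx' : Step R (σ₂ x) (D'.fill (r₁.subst σ₁)) := ⟨l₁, r₁, h₁, D', σ₁, hx, rfl⟩
    have hr : Relation.ReflTransGen (Step R) (r₂.subst σ₂)
        (r₂.subst (Function.update σ₂ x (D'.fill (r₁.subst σ₁)))) := by
      refine isRewriteRel_step.subst_reflTransGen (fun y => ?_) r₂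
      by_cases hy : y = x
      · subst hy; simpa using .single hx'
      · simpa [hy] using .refl
    have hgt₂ : gt ((C.fill (.var x)).subst σ₂) (r₂.subst σ₂) :=
      hgt.subst _ _ _ (H.oriented _ _ h₂)
    have hgt₁ : gt ((C.fill (.var x)).subst σ₂) (D.fill (r₁.subst σ₁)) := by
      rw [h]; exact hgt.ctx _ _ _ (hgt.subst _ _ _ (H.oriented _ _ h₁))
    obtain ⟨h₃, h₄⟩ := ConvBelow.of_steps hgt H.oriented
      (Set.subset_union_left (t := B)) hgt₂ hr
    refine ConvBelow.trans (.single hgt₁ h₄ (.inl ?_)) h₃.symm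
    exact ⟨_, _, .inl h₂, .hole, _, hl.symm, rfl⟩

/-- A peak in which the second redex lies below the first. It is split at an innermost redex
inside the inner one, and both parts are instances of `peak_of_prime`. -/
theorem peak_of_nested (H : PrimeCriticalConditions gt R B)
    {l₁ r₁ l₂ r₂ : Term ar V} {σ₁ σ₂ : V → Term ar V} {D : Ctx ar V}
    (h₁ : (l₁, r₁) ∈ R) (h₂ : (l₂, r₂) ∈ R) (h : l₂.subst σ₂ = D.fill (l₁.subst σ₁)) :
    ConvBelow gt (R ∪ B) (l₂.subst σ₂) (D.fill (r₁.subst σ₁)) (r₂.subst σ₂) := by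
  obtain ⟨K, l, r, σ, hlr, hK, hp⟩ := exists_innermost_redex (R := R) (t := l₁.subst σ₁)
    fun hnf => hnf _ ⟨l₁, r₁, h₁, .hole, σ₁, rfl, rfl⟩
  have hin := (H.peak_of_prime hlr h₁ hK hp).ctx H.order D
  have hout := H.peak_of_prime (D := D.comp K) hlr h₂ (by rw [h, hK, Ctx.fill_comp]) hp
  rw [Ctx.fill_comp] at hout
  rw [← h] at hin
  exact hin.symm.trans hout

theorem convBelow_of_peak (H : PrimeCriticalConditions gt R B)
    {s m t : Term ar V} (hs : Step R m s) (ht : Step R m t) :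
    ConvBelow gt (R ∪ B) m s t := by
  have hgs := H.order.gt_of_step H.oriented hs
  have hgt := H.order.gt_of_step H.oriented ht
  obtain ⟨l₁, r₁, h₁, C₁, σ₁, rfl, rfl⟩ := hs
  obtain ⟨l₂, r₂, h₂, C₂, σ₂, hm, rfl⟩ := ht
  rcases Ctx.fill_eq_fill_cases hm with ⟨D, hD, hC⟩ | ⟨D, hD, hC⟩ | ⟨G, hG₁, hG₂, hG₃, hG₄⟩
  · rw [hm, hC]
    exact (H.peak_of_nested h₁ h₂ hD).ctx H.order C₂
  · rw [hC]
    exact (H.peak_of_nested h₂ h₁ hD).symm.ctx H.order C₁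
  · -- parallel redexes commute
    obtain ⟨K, hK⟩ := hG₄ (r₁.subst σ₁)
    obtain ⟨K', hK'⟩ := hG₃ (r₂.subst σ₂)
    have h₃ : Step (R ∪ B) (C₁.fill (r₁.subst σ₁)) (G (r₁.subst σ₁) (r₂.subst σ₂)) :=
      ⟨l₂, r₂, .inl h₂, K, σ₂, by rw [hG₁, hK], hK _⟩
    have h₄ : Step (R ∪ B) (C₂.fill (r₂.subst σ₂)) (G (r₁.subst σ₁) (r₂.subst σ₂)) :=
      ⟨l₁, r₁, .inl h₁, K', σ₁, by rw [hG₂, hK'], hK' _⟩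
    have h₅ : gt (C₁.fill (l₁.subst σ₁)) (G (r₁.subst σ₁) (r₂.subst σ₂)) := by
      refine H.order.trans _ _ _ hgs ?_
      rw [hG₁, hK, hK]
      exact H.order.ctx _ _ _ (H.order.subst _ _ _ (H.oriented _ _ h₂))
    exact (ConvBelow.single hgs h₅ (.inl h₃)).trans (.single h₅ hgt (.inr h₄))

/-- A cliff in which the innermost rewrite step takes place below the equational step. -/
theorem cliff_of_prime (H : PrimeCriticalConditions gt R B)
    {l₁ r₁ l₂ r₂ : Term ar V} {σ₁ σ₂ : V → Term ar V} {D : Ctx ar V}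
    (h₁ : (l₁, r₁) ∈ R) (h₂ : (l₂, r₂) ∈ symmEqs B)
    (h : l₂.subst σ₂ = D.fill (l₁.subst σ₁))
    (hp : ∀ v, ProperSubterm v (l₁.subst σ₁) → IsNF R v) :
    ∃ c, Step R (r₂.subst σ₂) c ∧
      ConvBelow gt (R ∪ B) (l₂.subst σ₂) c (D.fill (r₁.subst σ₁)) := by
  classical
  have hgt := H.order
  have hsim := eqTheory_of_mem_symmEqs h₂
  rcases Term.subst_eq_fill_cases h with ⟨C, m, rfl, hm, hma, hD⟩ | ⟨C, x, D', rfl, hx, hD⟩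
  · have hvar : C = .hole → ¬ IsVariant (l₁, r₁) (C.fill m, r₂) := by
      -- a variant of a rule of `R` is decreasing, an equation of `B` is not
      rintro rfl ⟨π, hπ₁, hπ₂⟩
      have := hgt.subst (fun x => .var (π x)) _ _ (H.oriented _ _ h₁)
      change gt (l₁.rename π) (r₁.rename π) at this
      simp only at hπ₁ hπ₂
      rw [hπ₁, hπ₂] at this
      exact hgt.irrefl _ (hgt.eqTheory_trans hsim.symm this)
    obtain ⟨t, w, s, u, δ, hcp, ht, hw, hs, hu⟩ := exists_criticalPeak h₁ h₂ hm hma.symm hvar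
    obtain ⟨c, hc, hct⟩ := H.cliff t w s u hcp (isNF_of_properSubterm_subst hw hp)
    have := hct.subst hgt δ
    rw [ht, hs, ← hD] at this
    exact ⟨c.subst δ, hu ▸ isRewriteRel_step.subst δ hc, this⟩
  · have hxr : x ∈ r₂.vars := (H.linear _ _ h₂).2 (C.vars_subset_vars_fill _ rfl)
    obtain ⟨C', rfl⟩ := Term.exists_fill_var hxr
    have hl := (H.linear _ _ h₂).1.subst_update σ₂ (D'.fill (r₁.subst σ₁))
    have hr := (H.linear (C'.fill (.var x)) (C.fill (.var x)) h₂.symm).1.subst_update σ₂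
      (D'.fill (r₁.subst σ₁))
    rw [← hD] at hl
    have hstep : Step R ((C'.fill (.var x)).subst σ₂)
        ((C'.fill (.var x)).subst (Function.update σ₂ x (D'.fill (r₁.subst σ₁)))) :=
      ⟨l₁, r₁, h₁, (C'.subst σ₂).comp D', σ₁,
        by rw [Ctx.fill_comp, Ctx.subst_fill, Term.subst, hx], by rw [Ctx.fill_comp, hr]⟩
    have hgt₁ : gt ((C.fill (.var x)).subst σ₂) (D.fill (r₁.subst σ₁)) := by
      rw [h]; exact hgt.ctx _ _ _ (hgt.subst _ _ _ (H.oriented _ _ h₁))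
    refine ⟨_, hstep, (ConvBelow.of_eqTheory hgt Set.subset_union_right hgt₁ ?_).symm⟩
    rw [← hl]
    exact isRewriteRel_eqTheory.subst _ hsim

/-- A cliff in which the rewrite step takes place below the equational step. -/
theorem cliff_of_nested (H : PrimeCriticalConditions gt R B)
    {l₁ r₁ l₂ r₂ : Term ar V} {σ₁ σ₂ : V → Term ar V} {D : Ctx ar V}
    (h₁ : (l₁, r₁) ∈ R) (h₂ : (l₂, r₂) ∈ symmEqs B)
    (h : l₂.subst σ₂ = D.fill (l₁.subst σ₁)) :
    ∃ c, Step R (r₂.subst σ₂) c ∧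
      ConvBelow gt (R ∪ B) (l₂.subst σ₂) c (D.fill (r₁.subst σ₁)) := by
  obtain ⟨K, l, r, σ, hlr, hK, hp⟩ := exists_innermost_redex (R := R) (t := l₁.subst σ₁)
    fun hnf => hnf _ ⟨l₁, r₁, h₁, .hole, σ₁, rfl, rfl⟩
  have hin := (H.peak_of_prime hlr h₁ hK hp).ctx H.order D
  obtain ⟨c, hc, hout⟩ := H.cliff_of_prime (D := D.comp K) hlr h₂
    (by rw [h, hK, Ctx.fill_comp]) hp
  rw [Ctx.fill_comp] at hout
  rw [← h] at hin
  exact ⟨c, hc, hout.trans hin⟩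

/-- A cliff in which the equational step takes place below the rewrite step. If the equational
redex has a reducible proper subterm, then the peak of the given step with an innermost step in
the equational redex and the cliff of that innermost step are combined. -/
theorem cliff'_of_nested (H : PrimeCriticalConditions gt R B)
    {l₁ r₁ l₂ r₂ : Term ar V} {σ₁ σ₂ : V → Term ar V} {D : Ctx ar V}
    (h₁ : (l₁, r₁) ∈ symmEqs B) (h₂ : (l₂, r₂) ∈ R)
    (h : l₂.subst σ₂ = D.fill (l₁.subst σ₁)) :
    ∃ c, Step R (D.fill (r₁.subst σ₁)) c ∧
      ConvBelow gt (R ∪ B) (l₂.subst σ₂) c (r₂.subst σ₂) := by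
  classical
  have hgt := H.order
  have hsim := eqTheory_of_mem_symmEqs h₁
  by_cases hp : ∀ v, ProperSubterm v (l₁.subst σ₁) → IsNF R v
  · rcases Term.subst_eq_fill_cases h with ⟨C, m, rfl, hm, hma, hD⟩ | ⟨C, x, D', rfl, hx, hD⟩
    · have hvar : C = .hole → ¬ IsVariant (l₁, r₁) (C.fill m, r₂) := by
        rintro rfl ⟨π, hπ₁, hπ₂⟩
        have := isRewriteRel_eqTheory.subst (fun x => .var (π x)) hsim
        change EqTheory B (l₁.rename π) (r₁.rename π) at this
        simp only at hπ₁ hπ₂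
        rw [hπ₁, hπ₂] at this
        exact hgt.irrefl _ (hgt.eqTheory_trans this.symm (H.oriented _ _ h₂))
      obtain ⟨t, w, s, u, δ, hcp, ht, hw, hs, hu⟩ := exists_criticalPeak h₁ h₂ hm hma.symm hvar
      obtain ⟨c, hc, hct⟩ := H.cliff' t w s u hcp (isNF_of_properSubterm_subst hw hp)
      have := hct.subst hgt δ
      have hc := isRewriteRel_step.subst δ hc
      rw [ht, ← hD] at hc
      rw [hs, hu] at this
      exact ⟨c.subst δ, hc, this⟩
    · have hl := (H.leftLinear _ _ h₂).subst_update σ₂ (D'.fill (r₁.subst σ₁))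
      rw [← hD] at hl
      have hx' : EqTheory B (σ₂ x) (D'.fill (r₁.subst σ₁)) := by
        rw [hx]
        exact isRewriteRel_eqTheory.ctx D' (isRewriteRel_eqTheory.subst σ₁ hsim)
      have hr : EqTheory B (r₂.subst σ₂)
          (r₂.subst (Function.update σ₂ x (D'.fill (r₁.subst σ₁)))) := by
        refine isRewriteRel_symStep.subst_reflTransGen (fun y => ?_) r₂
        by_cases hy : y = x
        · subst hy; rw [Function.update_self]; exact hx'
        · simpa [hy] using .refl
      refine ⟨_, ⟨_, _, h₂, .hole, _, hl.symm, rfl⟩, ConvBelow.symm ?_⟩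
      exact .of_eqTheory hgt Set.subset_union_right
        (hgt.subst _ _ _ (H.oriented _ _ h₂)) hr
  · push Not at hp
    obtain ⟨v, ⟨D', -, hv⟩, hv'⟩ := hp
    simp only [IsNF, not_forall, not_not] at hv'
    obtain ⟨u, hu⟩ := hv'
    obtain ⟨K, l, r, σ, hlr, hK, hp⟩ := exists_innermost_redex (R := R) (t := l₁.subst σ₁)
      fun hnf => hnf _ (hv ▸ isRewriteRel_step.ctx D' hu)
    obtain ⟨c, hc, hcv⟩ := H.cliff_of_prime hlr h₁ hK hp
    have hpeak := H.peak_of_prime (D := D.comp K) hlr h₂ (by rw [h, hK, Ctx.fill_comp]) hp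
    rw [Ctx.fill_comp] at hpeak
    have hcv := hcv.ctx hgt D
    rw [← h] at hcv
    exact ⟨_, isRewriteRel_step.ctx D hc, hcv.trans hpeak⟩

theorem convBelow_of_cliff (H : PrimeCriticalConditions gt R B)
    {s m t : Term ar V} (hs : Step R m s) (ht : SymStep B m t) :
    ∃ c, Step R t c ∧ ConvBelow gt (R ∪ B) m c s := by
  have hgs := H.order.gt_of_step H.oriented hs
  have hmt := EqTheory.of_symStep ht
  rw [← step_symmEqs_iff] at ht
  obtain ⟨l₁, r₁, h₁, C₁, σ₁, rfl, rfl⟩ := hs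
  obtain ⟨l₂, r₂, h₂, C₂, σ₂, hm, rfl⟩ := ht
  rcases Ctx.fill_eq_fill_cases hm with ⟨D, hD, hC⟩ | ⟨D, hD, hC⟩ | ⟨G, hG₁, hG₂, hG₃, hG₄⟩
  · obtain ⟨c, hc, hc'⟩ := H.cliff_of_nested h₁ h₂ hD
    rw [hm, hC]
    exact ⟨_, isRewriteRel_step.ctx C₂ hc, hc'.ctx H.order C₂⟩
  · obtain ⟨c, hc, hc'⟩ := H.cliff'_of_nested h₂ h₁ hD
    rw [hC]
    exact ⟨_, isRewriteRel_step.ctx C₁ hc, hc'.ctx H.order C₁⟩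
  · -- parallel steps commute
    obtain ⟨K, hK⟩ := hG₄ (r₁.subst σ₁)
    obtain ⟨K', hK'⟩ := hG₃ (r₂.subst σ₂)
    refine ⟨G (r₁.subst σ₁) (r₂.subst σ₂), ⟨l₁, r₁, h₁, K', σ₁, by rw [hG₂, hK'], hK' _⟩,
      (ConvBelow.of_eqTheory H.order Set.subset_union_right hgs ?_).symm⟩
    rw [hG₁, hK, hK]
    exact isRewriteRel_eqTheory.ctx K (isRewriteRel_eqTheory.subst σ₂ (eqTheory_of_mem_symmEqs h₂))

theorem churchRosserModulo (H : PrimeCriticalConditions gt R B) :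
    ChurchRosserModulo (Step R) (EqTheory B) :=
  churchRosserModulo_of_peaks_of_cliffs H.order H.oriented
    (fun _ _ _ => H.convBelow_of_peak) fun _ _ _ => H.convBelow_of_cliff

end PrimeCriticalConditions

end LocalAnalysis


section Runs

variable {F : Type u} {ar : F → ℕ} {V : Type v} {B : Set (Term ar V × Term ar V)}
  {gt : Term ar V → Term ar V → Prop}

/-! ### The equations of associativity and commutativity -/

theorem Term.vars_app₂ {f : F} (hf : ar f = 2) (s t : Term ar V) :
    (app₂ f s t).vars = s.vars ∪ t.vars := by
  ext x
  simp only [app₂, vars, Set.mem_iUnion, Set.mem_union]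
  constructor
  · rintro ⟨i, hi⟩
    split_ifs at hi
    exacts [.inl hi, .inr hi]
  · rintro (h | h)
    · exact ⟨⟨0, by omega⟩, by simpa using h⟩
    · exact ⟨⟨1, by omega⟩, by simpa using h⟩

theorem Term.IsLinear.app₂ {f : F} (hf : ar f = 2) {s t : Term ar V} (hs : s.IsLinear)
    (ht : t.IsLinear) (h : Disjoint s.vars t.vars) : (Term.app₂ f s t).IsLinear := by
  refine ⟨fun i => ?_, fun i j hij => ?_⟩
  · dsimp only
    split_ifs
    exacts [hs, ht]
  · dsimp only
    have hi := i.isLt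
    have hj := j.isLt
    have hij' : i.val ≠ j.val := fun h => hij (Fin.ext h)
    by_cases h₀ : i.val = 0
    · rw [if_pos h₀, if_neg (by omega)]
      exact h
    · rw [if_neg h₀, if_pos (by omega)]
      exact h.symm

theorem linear_of_mem_AC {ac : Set F} (hac : ∀ f ∈ ac, ar f = 2) {l r : Term ar V}
    (h : (l, r) ∈ AC (V := V) ac) : l.IsLinear ∧ r.IsLinear ∧ l.vars = r.vars := by
  rcases h with ⟨f, hf, x, y, hxy, h⟩ | ⟨f, hf, x, y, z, hxy, hyz, hxz, h⟩
  · obtain ⟨rfl, rfl⟩ := Prod.mk.inj h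
    have h₂ := hac f hf
    refine ⟨.app₂ h₂ trivial trivial ?_, .app₂ h₂ trivial trivial ?_, ?_⟩
    · simpa [Term.vars] using hxy
    · simpa [Term.vars] using hxy.symm
    · rw [Term.vars_app₂ h₂, Term.vars_app₂ h₂, Set.union_comm]
  · obtain ⟨rfl, rfl⟩ := Prod.mk.inj h
    have h₂ := hac f hf
    refine ⟨.app₂ h₂ (.app₂ h₂ trivial trivial ?_) trivial ?_,
      .app₂ h₂ trivial (.app₂ h₂ trivial trivial ?_) ?_, ?_⟩
    · simpa [Term.vars] using hxy
    · simp [Term.vars_app₂ h₂, Term.vars, hxz.symm, hyz.symm]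
    · simpa [Term.vars] using hyz
    · simp [Term.vars_app₂ h₂, Term.vars, hxy, hxz]
    · simp only [Term.vars_app₂ h₂, Set.union_assoc]

theorem linear_of_mem_symmEqs_AC {ac : Set F} (hac : ∀ f ∈ ac, ar f = 2) {l r : Term ar V}
    (h : (l, r) ∈ symmEqs (AC (V := V) ac)) : l.IsLinear ∧ l.vars ⊆ r.vars := by
  rcases h with h | h
  · obtain ⟨h₁, -, h₂⟩ := linear_of_mem_AC hac h
    exact ⟨h₁, h₂.subset⟩
  · obtain ⟨-, h₁, h₂⟩ := linear_of_mem_AC hac h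
    exact ⟨h₁, h₂.symm.subset⟩

/-! ### Runs of left-linear completion -/

theorem step_union_iff {E E' : Set (Term ar V × Term ar V)} {s t : Term ar V} :
    Step (E ∪ E') s t ↔ Step E s t ∨ Step E' s t := by
  constructor
  · rintro ⟨l, r, h | h, h'⟩
    exacts [.inl ⟨l, r, h, h'⟩, .inr ⟨l, r, h, h'⟩]
  · rintro (h | h)
    exacts [h.mono Set.subset_union_left, h.mono Set.subset_union_right]

theorem IA.oriented {st st' : State ar V} (hgt : IsReductionOrder B gt) (h : IA B gt st st')
    (hR : ∀ l r, (l, r) ∈ st.2 → gt l r) : ∀ l r, (l, r) ∈ st'.2 → gt l r := by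
  cases h with
  | deducePeak | delete | simplify => exact hR
  | deduceCliff E R s m t h₁ h₂ =>
    rintro l r (h | h)
    · exact hR l r h
    · obtain ⟨rfl, rfl⟩ := Prod.mk.inj h
      exact hgt.eqTheory_trans (EqTheory.of_symStep h₂).symm (hgt.gt_of_step hR h₁)
  | orient E R s t e he hd h =>
    rintro l r (h' | h')
    · exact hR l r h'
    · obtain ⟨rfl, rfl⟩ := Prod.mk.inj h'
      exact h
  | collapse E R s t u hd h => exact fun l r h => hR l r (.inl h)
  | compose E R s t u hd h =>
    rintro l r (h' | h')
    · exact hR l r (.inl h')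
    · obtain ⟨rfl, rfl⟩ := Prod.mk.inj h'
      exact hgt.trans _ _ _ (hR _ _ (.inr rfl))
        (hgt.gt_of_stepMod (fun l r h => hR l r (.inl h)) h)

/-- How a step with the equations and rules before an inference is replaced after it. -/
theorem IA.replace_step {st st' : State ar V} (h : IA B gt st st') {a b : Term ar V}
    (hab : Step (st.1 ∪ st.2) a b) :
    SymStep (st'.1 ∪ st'.2) a b ∨ EqTheory B a b ∨
      (∃ c, StepMod st'.2 B a c ∧ SymStep (st'.1 ∪ st'.2) c b) ∨
      ∃ c, StepMod st'.2 B b c ∧ SymStep (st'.1 ∪ st'.2) c a := by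
  obtain ⟨l, r, hlr, C, σ, rfl, rfl⟩ := hab
  suffices H : SymStep (st'.1 ∪ st'.2) l r ∨ EqTheory B l r ∨
      (∃ c, StepMod st'.2 B l c ∧ SymStep (st'.1 ∪ st'.2) c r) ∨
      ∃ c, StepMod st'.2 B r c ∧ SymStep (st'.1 ∪ st'.2) c l by
    rcases H with h | h | ⟨c, h₁, h₂⟩ | ⟨c, h₁, h₂⟩
    · exact .inl (isRewriteRel_symStep.ctx C (isRewriteRel_symStep.subst σ h))
    · exact .inr (.inl (isRewriteRel_eqTheory.ctx C (isRewriteRel_eqTheory.subst σ h)))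
    · exact .inr (.inr (.inl ⟨_, isRewriteRel_stepMod.ctx C (isRewriteRel_stepMod.subst σ h₁),
        isRewriteRel_symStep.ctx C (isRewriteRel_symStep.subst σ h₂)⟩))
    · exact .inr (.inr (.inr ⟨_, isRewriteRel_stepMod.ctx C (isRewriteRel_stepMod.subst σ h₁),
        isRewriteRel_symStep.ctx C (isRewriteRel_symStep.subst σ h₂)⟩))
  have keep : ∀ {S : Set (Term ar V × Term ar V)}, (l, r) ∈ S → SymStep S l r :=
    fun h => .inl (step_of_mem h)
  cases h with
  | deducePeak E R s m t h₁ h₂ => exact .inl (keep (hlr.imp .inl id))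
  | deduceCliff E R s m t h₁ h₂ => exact .inl (keep (hlr.imp id .inl))
  | orient E R s t e he hd h =>
    rcases hlr with (hlr | rfl) | hlr
    · exact .inl (keep (.inl hlr))
    · rcases he with he | he <;> obtain ⟨rfl, rfl⟩ := Prod.mk.inj he
      · exact .inl (.inl (step_of_mem (.inr (.inr rfl))))
      · exact .inl (.inr (step_of_mem (.inr (.inr rfl))))
    · exact .inl (keep (.inr (.inl hlr)))
  | delete E R s t hd h =>
    rcases hlr with (hlr | hlr) | hlr
    · exact .inl (keep (.inl hlr))
    · obtain ⟨rfl, rfl⟩ := Prod.mk.inj hlr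
      exact .inr (.inl h)
    · exact .inl (keep (.inr hlr))
  | simplify E R s t u e he hd h =>
    rcases hlr with (hlr | rfl) | hlr
    · exact .inl (keep (.inl (.inl hlr)))
    · have hut : SymStep (E ∪ {(u, t)} ∪ R) u t := .inl (step_of_mem (.inl (.inr rfl)))
      rcases he with he | he <;> obtain ⟨rfl, rfl⟩ := Prod.mk.inj he
      · exact .inr (.inr (.inl ⟨u, h, hut⟩))
      · exact .inr (.inr (.inr ⟨u, h, hut⟩))
    · exact .inl (keep (.inr hlr))
  | collapse E R s t u hd h =>
    rcases hlr with hlr | hlr | hlr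
    · exact .inl (keep (.inl (.inl hlr)))
    · exact .inl (keep (.inr hlr))
    · obtain ⟨rfl, rfl⟩ := Prod.mk.inj hlr
      exact .inr (.inr (.inl ⟨u, h.stepMod, .inl (step_of_mem (.inl (.inr rfl)))⟩))
  | compose E R s t u hd h =>
    rcases hlr with hlr | hlr | hlr
    · exact .inl (keep (.inl hlr))
    · exact .inl (keep (.inr (.inl hlr)))
    · obtain ⟨rfl, rfl⟩ := Prod.mk.inj hlr
      exact .inr (.inr (.inr ⟨u, h.mono Set.subset_union_left,
        .inr (step_of_mem (.inr (.inr rfl)))⟩))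

/-- A term that is reducible before an inference remains reducible after it, with a reduct close
to the old one. It is essential that collapsing does not use `B`. -/
theorem IA.replace_rule_step {st st' : State ar V} (h : IA B gt st st') {a b : Term ar V}
    (hab : Step st.2 a b) :
    ∃ c, Step st'.2 a c ∧ (c = b ∨ SymStep (st'.1 ∪ st'.2) c b ∨ StepMod st'.2 B b c) := by
  obtain ⟨l, r, hlr, C, σ, rfl, rfl⟩ := hab
  have keep : ∀ {S S' : Set (Term ar V × Term ar V)}, (l, r) ∈ S →
      ∃ c, Step S (C.fill (l.subst σ)) c ∧ (c = C.fill (r.subst σ) ∨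
        SymStep S' c (C.fill (r.subst σ)) ∨ StepMod S B (C.fill (r.subst σ)) c) :=
    fun h => ⟨_, ⟨l, r, h, C, σ, rfl, rfl⟩, .inl rfl⟩
  cases h with
  | deducePeak | delete | simplify => exact keep hlr
  | deduceCliff | orient => exact keep (.inl hlr)
  | collapse E R s t u hd h =>
    rcases hlr with hlr | hlr
    · exact keep hlr
    · obtain ⟨rfl, rfl⟩ := Prod.mk.inj hlr
      exact ⟨C.fill (u.subst σ), isRewriteRel_step.ctx C (isRewriteRel_step.subst σ h),
        .inr (.inl (.inl ⟨u, r, .inl (.inr rfl), C, σ, rfl, rfl⟩))⟩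
  | compose E R s t u hd h =>
    rcases hlr with hlr | hlr
    · exact keep (.inl hlr)
    · obtain ⟨rfl, rfl⟩ := Prod.mk.inj hlr
      exact ⟨C.fill (u.subst σ), ⟨l, u, .inr rfl, C, σ, rfl, rfl⟩,
        .inr (.inr (isRewriteRel_stepMod.ctx C (isRewriteRel_stepMod.subst σ
          (h.mono Set.subset_union_left))))⟩

theorem IA.convBelow {st st' : State ar V} (hgt : IsReductionOrder B gt) (h : IA B gt st st')
    (hR : ∀ l r, (l, r) ∈ st'.2 → gt l r) {m a b : Term ar V}
    (hab : ConvBelow gt (st.1 ∪ st.2 ∪ B) m a b) : ConvBelow gt (st'.1 ∪ st'.2 ∪ B) m a b := by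
  have hRS : st'.2 ⊆ st'.1 ∪ st'.2 ∪ B := fun _ h => .inl (.inr h)
  have hSS : st'.1 ∪ st'.2 ⊆ st'.1 ∪ st'.2 ∪ B := Set.subset_union_left
  have hBS : B ⊆ st'.1 ∪ st'.2 ∪ B := Set.subset_union_right
  refine hab.le (fun _ => id) fun a b ha hb hab => ?_
  rcases step_union_iff.1 hab with hab | hab
  · rcases h.replace_step hab with h | h | ⟨c, h₁, h₂⟩ | ⟨c, h₁, h₂⟩
    · exact .single ha hb (h.mono hSS)
    · exact .of_eqTheory hgt hBS ha h
    · exact (ConvBelow.of_stepMod hgt hR hRS hBS ha h₁).trans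
        (.single (hgt.trans _ _ _ ha (hgt.gt_of_stepMod hR h₁)) hb (h₂.mono hSS))
    · exact ((ConvBelow.of_stepMod hgt hR hRS hBS hb h₁).trans
        (.single (hgt.trans _ _ _ hb (hgt.gt_of_stepMod hR h₁)) ha (h₂.mono hSS))).symm
  · exact .single ha hb (.inl (hab.mono hBS))

/-- Equations and rules before an inference are valid in every theory of those after it. -/
theorem IA.eqTheory_of_mem {st st' : State ar V} (h : IA B gt st st')
    {T : Set (Term ar V × Term ar V)} (hB : ∀ s t, (s, t) ∈ B → EqTheory T s t)
    (hT : ∀ s t, (s, t) ∈ st'.1 ∪ st'.2 → EqTheory T s t) :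
    ∀ s t, (s, t) ∈ st.1 ∪ st.2 → EqTheory T s t := by
  have hS : ∀ {s t}, SymStep (st'.1 ∪ st'.2) s t → EqTheory T s t :=
    fun h => EqTheory.le hT (.of_symStep h)
  have hM : ∀ {s t}, StepMod st'.2 B s t → EqTheory T s t := by
    rintro s t ⟨a, b, h₁, h₂, h₃⟩
    exact (EqTheory.le hB h₁).trans ((hS (.inl (h₂.mono Set.subset_union_right))).trans
      (EqTheory.le hB h₃))
  intro s t hst
  rcases h.replace_step (step_of_mem hst) with h | h | ⟨c, h₁, h₂⟩ | ⟨c, h₁, h₂⟩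
  · exact hS h
  · exact EqTheory.le hB h
  · exact (hM h₁).trans (hS h₂)
  · exact ((hM h₁).trans (hS h₂)).symm

namespace IsRunIA

variable {n : ℕ} {E R : ℕ → Set (Term ar V × Term ar V)}

theorem oriented (hgt : IsReductionOrder B gt) (h : IsRunIA B gt n E R) {i : ℕ} (hi : i ≤ n) :
    ∀ l r, (l, r) ∈ R i → gt l r := by
  induction i with
  | zero => intro l r hlr; rw [h.1] at hlr; exact absurd hlr (Set.notMem_empty _)
  | succ i ih => exact (h.2 i hi).oriented hgt (ih (by omega))

theorem convBelow (hgt : IsReductionOrder B gt) (h : IsRunIA B gt n E R) {i j : ℕ} (hij : i ≤ j)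
    (hj : j ≤ n) {m s t : Term ar V} (hst : ConvBelow gt (E i ∪ R i ∪ B) m s t) :
    ConvBelow gt (E j ∪ R j ∪ B) m s t := by
  induction j, hij using Nat.le_induction with
  | base => exact hst
  | succ j hij ih => exact (h.2 j hj).convBelow hgt (h.oriented hgt hj) (ih (by omega))

/-- A rewrite step at some stage has a counterpart with the same source at every later stage, and
its target is connected to the old one below the source. -/
theorem exists_step (hgt : IsReductionOrder B gt) (h : IsRunIA B gt n E R) {i j : ℕ}
    (hij : i ≤ j) (hj : j ≤ n) {s t : Term ar V} (hst : Step (R i) s t) :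
    ∃ c, Step (R j) s c ∧ ConvBelow gt (E j ∪ R j ∪ B) s c t := by
  induction j, hij using Nat.le_induction with
  | base => exact ⟨t, hst, .refl _ _⟩
  | succ j hij ih =>
    obtain ⟨c, hc, hct⟩ := ih (by omega)
    have hR := h.oriented hgt hj
    have hct := (h.2 j hj).convBelow hgt hR hct
    have hgc := hgt.gt_of_step (h.oriented hgt (by omega)) hc
    obtain ⟨d, hd, hdc⟩ := (h.2 j hj).replace_rule_step hc
    refine ⟨d, hd, ConvBelow.trans ?_ hct⟩
    rcases hdc with rfl | hdc | hdc
    · exact .refl _ _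
    · exact .single (hgt.gt_of_step hR hd) hgc (hdc.mono Set.subset_union_left)
    · exact (ConvBelow.of_stepMod hgt hR (fun _ h => .inl (.inr h)) Set.subset_union_right hgc
        hdc).symm

theorem eqTheory_of_mem (h : IsRunIA B gt n E R) {i : ℕ} (hi : i ≤ n) :
    ∀ s t, (s, t) ∈ E i ∪ R i → EqTheory (E n ∪ R n ∪ B) s t := by
  induction hi using Nat.decreasingInduction with
  | self => exact fun s t hst => .of_step (step_of_mem (.inl hst))
  | of_succ i hi ih =>
    exact (h.2 i hi).eqTheory_of_mem (fun s t hst => .of_step (step_of_mem (.inr hst))) ih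

end IsRunIA

/-! ### Fair runs -/

theorem exists_step_of_isVariant {E : Set (Term ar V × Term ar V)} {l r : Term ar V}
    (h : ∃ ρ ∈ E, IsVariant ρ (l, r)) : Step E l r := by
  obtain ⟨ρ, hρ, π, h₁, h₂⟩ := h
  exact ⟨ρ.1, ρ.2, hρ, .hole, fun x => .var (π x), h₁.symm, h₂.symm⟩

theorem CriticalPeak.steps {R₁ R₂ : Set (Term ar V × Term ar V)} {t w s u : Term ar V}
    (h : CriticalPeak R₁ R₂ t w s u) : Step R₁ s t ∧ Step R₂ s u := by
  obtain ⟨l₁, r₁, l₂, r₂, h₁, h₂, -, C, m, σ, rfl, -, hσ, -, rfl, -, rfl, rfl⟩ := h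
  refine ⟨?_, isRewriteRel_step.subst σ (exists_step_of_isVariant h₂)⟩
  rw [Ctx.subst_fill, ← hσ.1]
  exact isRewriteRel_step.ctx _ (isRewriteRel_step.subst σ (exists_step_of_isVariant h₁))

/-- The final system of a fair run in which all equations have been processed satisfies the
conditions on prime critical peaks. -/
theorem IsRunIA.primeCriticalConditions {n : ℕ} {E R : ℕ → Set (Term ar V × Term ar V)}
    (hgt : IsReductionOrder B gt) (h : IsRunIA B gt n E R)
    (hB : ∀ l r, (l, r) ∈ symmEqs B → l.IsLinear ∧ l.vars ⊆ r.vars)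
    (hfair : IsFairIA B n E R) (hn : E n = ∅) : PrimeCriticalConditions gt (R n) B := by
  have hR := h.oriented hgt le_rfl
  obtain ⟨hlin, hpcp, hpcpm⟩ := hfair
  have hRn : E n ∪ R n ∪ B = R n ∪ B := by rw [hn, Set.empty_union]
  have valley : ∀ m s t, gt m s → gt m t → Valley (Step (R n)) (EqTheory B) s t →
      ConvBelow gt (R n ∪ B) m s t := by
    rintro m s t hs ht ⟨a, b, ha, hab, hb⟩
    obtain ⟨h₁, h₂⟩ := ConvBelow.of_steps hgt hR (Set.subset_union_left (t := B)) hs ha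
    exact (h₁.trans (.of_eqTheory hgt Set.subset_union_right h₂ hab)).trans
      (ConvBelow.of_steps hgt hR Set.subset_union_left ht hb).1.symm
  -- in a joinable cliff the equational side is reducible, since it is above the other side
  have cliff : ∀ m s t, Step (R n) m s → EqTheory B m t →
      (Valley (Step (R n)) (EqTheory B) s t ∨ ∃ i ≤ n, SymStep (R i) s t) →
      ∃ c, Step (R n) t c ∧ ConvBelow gt (R n ∪ B) m c s := by
    rintro m s t hs hmt (⟨a, b, ha, hab, hb⟩ | ⟨i, hi, hst⟩)
    · have hms := hgt.gt_of_step hR hs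
      obtain ⟨-, hma⟩ := ConvBelow.of_steps hgt hR (Set.subset_union_left (t := B)) hms ha
      rcases hb.cases_head with rfl | ⟨c, hc, hcb⟩
      · exact absurd (hgt.trans_eqTheory hma (hab.trans hmt.symm)) (hgt.irrefl m)
      · exact ⟨c, hc, (valley m s c hms (hgt.eqTheory_trans hmt (hgt.gt_of_step hR hc))
          ⟨a, b, ha, hab, hcb⟩).symm⟩
    · rcases hst with hst | hst
      · exact absurd (hgt.trans _ _ _ (hgt.gt_of_step hR hs)
          (hgt.trans_eqTheory (hgt.gt_of_step (h.oriented hgt hi) hst) hmt.symm)) (hgt.irrefl m)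
      · obtain ⟨c, hc, hcs⟩ := h.exists_step hgt hi le_rfl hst
        rw [hRn] at hcs
        exact ⟨c, hc, hcs.mono_right fun a => hgt.eqTheory_trans hmt⟩
  refine ⟨hgt, hR, hlin, hB, ?_, ?_, ?_⟩
  · intro t w s u hcp hp
    have ht := hgt.gt_of_step hR hcp.steps.1
    have hu := hgt.gt_of_step hR hcp.steps.2
    rcases hpcp t u ⟨w, s, hcp, hp⟩ with hv | ⟨i, hi, hst⟩
    · exact valley s t u ht hu hv
    · rw [← hRn]
      exact h.convBelow hgt hi le_rfl (.single ht hu (hst.mono Set.subset_union_left))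
  · intro t w s u hcp hp
    exact cliff s t u hcp.steps.1 (.of_symStep (step_symmEqs_iff.1 hcp.steps.2))
      (hpcpm t u (.inl ⟨w, s, hcp, hp⟩))
  · intro t w s u hcp hp
    refine cliff s u t hcp.steps.2 (.of_symStep (step_symmEqs_iff.1 hcp.steps.1)) ?_
    rcases hpcpm t u (.inr ⟨w, s, hcp, hp⟩) with ⟨a, b, h₁, h₂, h₃⟩ | ⟨i, hi, hst⟩
    · exact .inl ⟨b, a, h₃, h₂.symm, h₁⟩
    · exact .inr ⟨i, hi, hst.symm⟩

end Runs


section Simulation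

variable {F : Type u} {ar : F → ℕ} {V : Type v} {B R R' : Set (Term ar V × Term ar V)}
  {gt : Term ar V → Term ar V → Prop}

/-! ### Simulation by general completion -/

/-- `s` rewrites to `t` by `s ∼ · →_R d →*_{R/B} t`. In contrast to a nonempty sequence of
`R/B`-steps, no `B`-equivalence follows the first step. A peak of two such sequences can therefore
be reproduced by deducing the pair of the first reducts and simplifying it. -/
def LeadsTo (R B : Set (Term ar V × Term ar V)) (s t : Term ar V) : Prop :=
  ∃ m d, EqTheory B s m ∧ Step R m d ∧ Relation.ReflTransGen (StepMod R B) d t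

/-- The equation `s ≈ t` comes from a peak of `R` modulo `B`. -/
def IsPeak (R B : Set (Term ar V × Term ar V)) (s t : Term ar V) : Prop :=
  ∃ m, LeadsTo R B m s ∧ LeadsTo R B m t

namespace LeadsTo

theorem of_mem {s t : Term ar V} (h : (s, t) ∈ R) : LeadsTo R B s t :=
  ⟨s, t, .refl s, step_of_mem h, .refl⟩

theorem mono (h : R ⊆ R') {s t : Term ar V} (hst : LeadsTo R B s t) : LeadsTo R' B s t := by
  obtain ⟨m, d, h₁, h₂, h₃⟩ := hst
  exact ⟨m, d, h₁, h₂.mono h, Relation.ReflTransGen.mono (fun _ _ => StepMod.mono h) _ _ h₃⟩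

theorem trans {s t u : Term ar V} (h : LeadsTo R B s t)
    (h' : Relation.ReflTransGen (StepMod R B) t u) : LeadsTo R B s u := by
  obtain ⟨m, d, h₁, h₂, h₃⟩ := h
  exact ⟨m, d, h₁, h₂, h₃.trans h'⟩

theorem eqTheory_trans {s t u : Term ar V} (h : EqTheory B s t) (h' : LeadsTo R B t u) :
    LeadsTo R B s u := by
  obtain ⟨m, d, h₁, h₂, h₃⟩ := h'
  exact ⟨m, d, h.trans h₁, h₂, h₃⟩

theorem isRewriteRel : IsRewriteRel (LeadsTo R B) := by
  refine ⟨fun C s t ⟨m, d, h₁, h₂, h₃⟩ => ?_, fun σ s t ⟨m, d, h₁, h₂, h₃⟩ => ?_⟩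
  · exact ⟨_, _, isRewriteRel_eqTheory.ctx C h₁, isRewriteRel_step.ctx C h₂,
      isRewriteRel_stepMod.reflTransGen.ctx C h₃⟩
  · exact ⟨_, _, isRewriteRel_eqTheory.subst σ h₁, isRewriteRel_step.subst σ h₂,
      isRewriteRel_stepMod.reflTransGen.subst σ h₃⟩

theorem transGen {s t : Term ar V} (h : LeadsTo R B s t) :
    Relation.TransGen (StepMod R B) s t := by
  obtain ⟨m, d, h₁, h₂, h₃⟩ := h
  exact Relation.TransGen.head' ⟨m, d, h₁, h₂, .refl d⟩ h₃

/-- Rewriting modulo `B` absorbs `B`-equivalence at the end of a nonempty sequence. -/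
theorem transGen_of_eqTheory {s t u : Term ar V} (h : LeadsTo R B s t) (h' : EqTheory B t u) :
    Relation.TransGen (StepMod R B) s u := by
  obtain ⟨w, hw, a, b, h₁, h₂, h₃⟩ := Relation.TransGen.tail'_iff.1 h.transGen
  exact Relation.TransGen.tail' hw ⟨a, b, h₁, h₂, h₃.trans h'⟩

end LeadsTo

theorem transGen_of_stepMod (h : ∀ l r, (l, r) ∈ R → LeadsTo R' B l r) {s t : Term ar V}
    (hst : StepMod R B s t) : Relation.TransGen (StepMod R' B) s t := by
  obtain ⟨a, b, h₁, h₂, h₃⟩ := hst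
  exact (LeadsTo.eqTheory_trans h₁ (LeadsTo.isRewriteRel.step_le h h₂)).transGen_of_eqTheory h₃

theorem IsPeak.symm {s t : Term ar V} (h : IsPeak R B s t) : IsPeak R B t s := by
  obtain ⟨m, h₁, h₂⟩ := h
  exact ⟨m, h₂, h₁⟩

theorem IsPeak.mono (h : R ⊆ R') {s t : Term ar V} (hst : IsPeak R B s t) : IsPeak R' B s t := by
  obtain ⟨m, h₁, h₂⟩ := hst
  exact ⟨m, h₁.mono h, h₂.mono h⟩

/-- General completion simplifies an equation by several steps, without losing any other equation.
If an equation `(a', t)` needed as an intermediate result is already present, it is the one to be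
simplified to the final result, and the given equation then takes its place. -/
theorem KB.simplify_transGen (hgt : IsReductionOrder B gt) (hR : ∀ l r, (l, r) ∈ R → gt l r)
    {a c : Term ar V} (h : Relation.TransGen (StepMod R B) a c) (t : Term ar V)
    (e : Term ar V × Term ar V) (he : e = (a, t) ∨ e = (t, a)) (E : Set (Term ar V × Term ar V))
    (hd : e ∉ E) :
    Relation.ReflTransGen (KB B gt) (E ∪ {e}, R) (E ∪ {(c, t)}, R) := by
  induction h using Relation.TransGen.head_induction_on generalizing e E with
  | single h => exact .single (.simplify E R _ t c e he hd h)
  | @head a a' h h' ih =>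
    by_cases ha' : (a', t) ∈ E
    · have hac : a ≠ c := by
        rintro rfl
        exact hgt.irrefl _ (hgt.trans _ _ _ (hgt.gt_of_stepMod hR h)
          (hgt.gt_of_transGen_stepMod hR h'))
      have hne : e ≠ (a', t) := fun h => hd (h ▸ ha')
      have hne' : e ≠ (c, t) := by
        rcases he with rfl | rfl
        · exact fun h => hac (Prod.mk.inj h).1
        · exact fun h => hac ((Prod.mk.inj h).2.trans (Prod.mk.inj h).1)
      have h₁ := ih (a', t) (.inl rfl) ((E \ {(a', t)}) ∪ {e}) (by
        rintro (h | h)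
        · exact h.2 rfl
        · exact hne h.symm)
      have h₂ : KB B gt ((E \ {(a', t)} ∪ {(c, t)}) ∪ {e}, R)
          ((E \ {(a', t)} ∪ {(c, t)}) ∪ {(a', t)}, R) :=
        .simplify _ R a t a' e he (by
          rintro (h | h)
          · exact hd h.1
          · exact hne' h) h
      have hE : E \ {(a', t)} ∪ {(a', t)} = E :=
        Set.sdiff_union_of_subset (Set.singleton_subset_iff.2 ha')
      rw [Set.union_right_comm, hE] at h₁
      rw [Set.union_right_comm (E \ {(a', t)}) {(c, t)} {(a', t)}, hE] at h₂
      rw [Set.union_right_comm] at h₁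
      exact h₁.tail h₂
    · exact .head (.simplify E R _ t a' e he hd h) (ih (a', t) (.inl rfl) E ha')

/-- With the rules `R`, general completion can add the equation `e` to every set of equations. -/
def IsDerivable (B : Set (Term ar V × Term ar V)) (gt : Term ar V → Term ar V → Prop)
    (R : Set (Term ar V × Term ar V)) (e : Term ar V × Term ar V) : Prop :=
  ∀ E, Relation.ReflTransGen (KB B gt) (E, R) (E ∪ {e}, R)

theorem IsDerivable.simplify (hgt : IsReductionOrder B gt) (hR : ∀ l r, (l, r) ∈ R → gt l r)
    {a c t : Term ar V} {e : Term ar V × Term ar V} (h : IsDerivable B gt R e)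
    (he : e = (a, t) ∨ e = (t, a)) (hac : Relation.TransGen (StepMod R B) a c) :
    IsDerivable B gt R (c, t) := by
  intro E
  by_cases hE : e ∈ E
  · -- `e` is used up and then derived again
    have h₁ := KB.simplify_transGen hgt hR hac t e he (E \ {e}) fun h => h.2 rfl
    have h₂ := h (E \ {e} ∪ {(c, t)})
    rw [Set.union_right_comm] at h₂
    rw [Set.sdiff_union_of_subset (Set.singleton_subset_iff.2 hE)] at h₁ h₂
    exact h₁.trans h₂
  · exact (h E).trans (KB.simplify_transGen hgt hR hac t e he E hE)

theorem IsPeak.isDerivable (hgt : IsReductionOrder B gt) (hR : ∀ l r, (l, r) ∈ R → gt l r)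
    {s t : Term ar V} (h : IsPeak R B s t) :
    IsDerivable B gt R (s, t) ∨ IsDerivable B gt R (t, s) := by
  obtain ⟨m, ⟨m₁, a, h₁, h₂, h₃⟩, m₂, b, k₁, k₂, k₃⟩ := h
  have hab : IsDerivable B gt R (a, b) := fun E =>
    .single (.deduce E R a m₁ m₂ b h₂ (h₁.symm.trans k₁) k₂)
  have hsb : IsDerivable B gt R (s, b) := by
    rcases Relation.reflTransGen_iff_eq_or_transGen.1 h₃ with rfl | h₃
    · exact hab
    · exact hab.simplify hgt hR (.inl rfl) h₃
  rcases Relation.reflTransGen_iff_eq_or_transGen.1 k₃ with rfl | k₃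
  · exact .inl hsb
  · exact .inr (hsb.simplify hgt hR (.inr rfl) k₃)

/-- The state `(E', R')` of general completion simulates the state `(E, R)` of left-linear
completion. The equations agree up to orientation, and they agree exactly unless they come from
peaks and can be derived again. -/
structure Simulates (B : Set (Term ar V × Term ar V)) (gt : Term ar V → Term ar V → Prop)
    (E' R' E R : Set (Term ar V × Term ar V)) : Prop where
  oriented : ∀ l r, (l, r) ∈ R' → gt l r
  leadsTo : ∀ l r, (l, r) ∈ R → LeadsTo R' B l r
  symm : ∀ a b, (a, b) ∈ E' ∨ (b, a) ∈ E' ↔ (a, b) ∈ E ∨ (b, a) ∈ E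
  exact : ∀ a b, ¬ IsPeak R' B a b → ((a, b) ∈ E' ↔ (a, b) ∈ E)

namespace Simulates

variable {E' E : Set (Term ar V × Term ar V)}

theorem leadsTo_step (h : Simulates B gt E' R' E R) {s t : Term ar V} (hst : Step R s t) :
    LeadsTo R' B s t :=
  LeadsTo.isRewriteRel.step_le h.leadsTo hst

theorem exists_add (hgt : IsReductionOrder B gt) (h : Simulates B gt E' R' E R) {s t : Term ar V}
    (hst : IsPeak R' B s t) : ∃ E'', Relation.ReflTransGen (KB B gt) (E', R') (E'', R') ∧
      Simulates B gt E'' R' (E ∪ {(s, t)}) R := by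
  have key : ∀ e, e = (s, t) ∨ e = (t, s) →
      Simulates B gt (E' ∪ {e}) R' (E ∪ {(s, t)}) R := by
    intro e he
    refine ⟨h.oriented, h.leadsTo, fun a b => ?_, fun a b hab => ?_⟩
    · have := h.symm a b
      simp only [Set.mem_union, Set.mem_singleton_iff]
      grind
    · have h₁ : (a, b) ≠ (s, t) := by
        rintro ⟨⟩
        exact hab hst
      have h₂ : (a, b) ≠ (t, s) := by
        rintro ⟨⟩
        exact hab hst.symm
      have := h.exact a b hab
      simp only [Set.mem_union, Set.mem_singleton_iff]
      grind
  rcases hst.isDerivable hgt h.oriented with hd | hd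
  · exact ⟨_, hd E', key _ (.inl rfl)⟩
  · exact ⟨_, hd E', key _ (.inr rfl)⟩

/-- Inferences that replace an equation `e` by the set `X` of equations while the rules grow from
`R'` to `R''`. An equation that comes from a peak may be present in one orientation only although
both orientations are present in the simulated state; it is then derived again after having been
replaced. -/
theorem exists_replace (hgt : IsReductionOrder B gt) {e : Term ar V × Term ar V}
    {R'' X : Set (Term ar V × Term ar V)} {s t : Term ar V}
    (h : Simulates B gt E' R' (E ∪ {e}) R) (he : e = (s, t) ∨ e = (t, s)) (hd : e ∉ E)
    (hR : R' ⊆ R'') (hR'' : ∀ l r, (l, r) ∈ R'' → gt l r)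
    (h₁ : ∀ E₀ e', e' = (s, t) ∨ e' = (t, s) → e' ∉ E₀ →
      Relation.ReflTransGen (KB B gt) (E₀ ∪ {e'}, R') (E₀ ∪ X, R''))
    (h₂ : ∀ E₀ e', e' = (s, t) ∨ e' = (t, s) → e' ∉ E₀ →
      Relation.ReflTransGen (KB B gt) (E₀ ∪ {e'}, R'') (E₀ ∪ X, R'')) :
    ∃ E'', Relation.ReflTransGen (KB B gt) (E', R') (E'', R'') ∧
      Simulates B gt E'' R'' (E ∪ X) R := by
  have mem_diff : ∀ {e'}, e' ∈ E' → E' \ {e'} ∪ {e'} = E' := fun h =>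
    Set.sdiff_union_of_subset (Set.singleton_subset_iff.2 h)
  have hlead : ∀ l r, (l, r) ∈ R → LeadsTo R'' B l r := fun l r hlr => (h.leadsTo l r hlr).mono hR
  have exact' : ∀ a b, ¬ IsPeak R'' B a b → ((a, b) ∈ E' ↔ (a, b) ∈ E ∪ {e}) :=
    fun a b hab => h.exact a b fun hab' => hab (hab'.mono hR)
  by_cases hpeak : IsPeak R' B s t
  · have hpeak' := hpeak.mono hR
    have hne : ∀ a b, ¬ IsPeak R'' B a b → (a, b) ≠ (s, t) ∧ (a, b) ≠ (t, s) := by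
      intro a b hab
      constructor <;> rintro ⟨⟩
      exacts [hab hpeak', hab hpeak'.symm]
    have hmem : ∃ e', (e' = (s, t) ∨ e' = (t, s)) ∧ e' ∈ E' := by
      have := (h.symm e.1 e.2).2 (.inl (.inr rfl))
      rcases this with h | h
      · exact ⟨_, he, h⟩
      · exact ⟨_, by rcases he with rfl | rfl <;> simp, h⟩
    obtain ⟨e', he', hE'⟩ := hmem
    have step₁ := h₁ (E' \ {e'}) e' he' fun h => h.2 rfl
    rw [mem_diff hE'] at step₁
    by_cases hswap : e.swap ∈ E
    -- If both orientations of `e` are present in the simulated state, one of them remains there: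
    -- a present orientation is replaced, and the equation is derived again.
    · have fin : ∀ e'', e'' = (s, t) ∨ e'' = (t, s) →
          Simulates B gt (E' \ {e'} ∪ X ∪ {e''}) R'' (E ∪ X) R := by
        intro e'' he''
        refine ⟨hR'', hlead, fun a b => ?_, fun a b hab => ?_⟩
        · have := h.symm a b
          clear h₁ h₂ mem_diff hlead exact' hne hR'' hR h step₁ hpeak hpeak'
          simp only [Set.mem_union, Set.mem_singleton_iff, Set.mem_sdiff] at this ⊢
          rcases he with rfl | rfl <;> simp only [Prod.swap_prod_mk] at hswap <;> grind
        · have h₃ := exact' a b hab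
          have h₄ := hne a b hab
          clear h₁ h₂ mem_diff hlead exact' hne hR'' hR h step₁ hpeak hpeak'
          simp only [Set.mem_union, Set.mem_singleton_iff, Set.mem_sdiff] at h₃ ⊢
          grind
      rcases hpeak'.isDerivable hgt hR'' with hder | hder
      · exact ⟨_, step₁.trans (hder _), fin _ (.inl rfl)⟩
      · exact ⟨_, step₁.trans (hder _), fin _ (.inr rfl)⟩
    -- Otherwise every orientation that is present is replaced.
    · have fin : ∀ E'', (∀ a b, (a, b) ∈ E'' ↔
          ((a, b) ∈ E' ∧ (a, b) ≠ (s, t) ∧ (a, b) ≠ (t, s)) ∨ (a, b) ∈ X) →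
          Simulates B gt E'' R'' (E ∪ X) R := by
        intro E'' hE''
        refine ⟨hR'', hlead, fun a b => ?_, fun a b hab => ?_⟩
        · have := h.symm a b
          clear h₁ h₂ mem_diff hlead exact' hne hR'' hR h step₁ hpeak hpeak'
          rw [hE'', hE'']
          simp only [Set.mem_union, Set.mem_singleton_iff] at this ⊢
          rcases he with rfl | rfl <;> simp only [Prod.swap_prod_mk] at hswap <;> grind
        · have h₃ := exact' a b hab
          have h₄ := hne a b hab
          clear h₁ h₂ mem_diff hlead exact' hne hR'' hR h step₁ hpeak hpeak'
          rw [hE'']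
          simp only [Set.mem_union, Set.mem_singleton_iff] at h₃ ⊢
          grind
      by_cases hE'' : e'.swap ∈ E' \ {e'}
      · have step₂ := h₂ ((E' \ {e'} ∪ X) \ {e'.swap}) e'.swap
          (by rcases he' with rfl | rfl <;> simp) fun h => h.2 rfl
        rw [Set.sdiff_union_of_subset (Set.singleton_subset_iff.2 (.inl hE''))] at step₂
        refine ⟨_, step₁.trans step₂, fin _ fun a b => ?_⟩
        clear h₁ h₂ mem_diff hlead exact' hne hR'' hR h step₁ step₂ hpeak hpeak' fin he hd hswap
        simp only [Set.mem_union, Set.mem_singleton_iff, Set.mem_sdiff]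
        rcases he' with rfl | rfl <;> simp only [Prod.swap_prod_mk] at * <;> grind
      · refine ⟨_, step₁, fin _ fun a b => ?_⟩
        clear h₁ h₂ mem_diff hlead exact' hne hR'' hR h step₁ hpeak hpeak' fin he hd hswap
        simp only [Set.mem_union, Set.mem_singleton_iff, Set.mem_sdiff] at hE'' ⊢
        rcases he' with rfl | rfl <;> simp only [Prod.swap_prod_mk] at * <;> grind
  -- An equation that does not come from a peak is present with its orientation.
  · have hpe : ¬ IsPeak R' B e.1 e.2 := by
      rcases he with rfl | rfl
      exacts [hpeak, fun h => hpeak h.symm]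
    have heE' : e ∈ E' := (h.exact _ _ hpe).2 (.inr rfl)
    have step₁ := h₁ (E' \ {e}) e he fun h => h.2 rfl
    rw [mem_diff heE'] at step₁
    refine ⟨_, step₁, hR'', hlead, fun a b => ?_, fun a b hab => ?_⟩
    · have h₃ := h.symm a b
      simp only [Set.mem_union, Set.mem_singleton_iff, Set.mem_sdiff] at h₃ ⊢
      by_cases hab : IsPeak R' B a b
      · have h₄ : (a, b) ≠ e := by rintro rfl; exact hpe hab
        have h₅ : (b, a) ≠ e := by rintro rfl; exact hpe hab.symm
        clear h₁ h₂ mem_diff hlead exact' hR'' hR h step₁ hpeak hpe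
        grind
      · have h₄ := h.exact a b hab
        have h₅ := h.exact b a fun h => hab h.symm
        simp only [Set.mem_union, Set.mem_singleton_iff] at h₄ h₅
        clear h₁ h₂ mem_diff hlead exact' hR'' hR h step₁ hpeak hpe
        grind
    · have h₃ := exact' a b hab
      clear h₁ h₂ mem_diff hlead exact' hR'' hR h step₁ hpeak hpe
      simp only [Set.mem_union, Set.mem_singleton_iff, Set.mem_sdiff] at h₃ ⊢
      grind

/-- Every inference of left-linear completion is simulated by general completion. The rules of the
simulating state only grow, so that composed and collapsed rules are kept; cliffs need no
inference. -/
theorem exists_of_IA (hgt : IsReductionOrder B gt) {st st' : State ar V} (hst : IA B gt st st')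
    (h : Simulates B gt E' R' st.1 st.2) :
    ∃ E'' R'', Relation.ReflTransGen (KB B gt) (E', R') (E'', R'') ∧
      Simulates B gt E'' R'' st'.1 st'.2 := by
  cases hst with
  | deducePeak E R s m t h₁ h₂ =>
    obtain ⟨E'', h₃, h₄⟩ := h.exists_add hgt ⟨m, h.leadsTo_step h₁, h.leadsTo_step h₂⟩
    exact ⟨E'', R', h₃, h₄⟩
  | deduceCliff E R s m t h₁ h₂ =>
    refine ⟨E', R', .refl, h.oriented, ?_, h.symm, h.exact⟩
    rintro l r (hlr | hlr)
    · exact h.leadsTo l r hlr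
    · obtain ⟨rfl, rfl⟩ := Prod.mk.inj hlr
      exact .eqTheory_trans (EqTheory.of_symStep h₂).symm (h.leadsTo_step h₁)
  | orient E R s t e he hd hst =>
    have hR'' : ∀ l r, (l, r) ∈ R' ∪ {(s, t)} → gt l r := by
      rintro l r (hlr | hlr)
      · exact h.oriented l r hlr
      · obtain ⟨rfl, rfl⟩ := Prod.mk.inj hlr
        exact hst
    obtain ⟨E'', h₁, h₂⟩ := h.exists_replace (X := ∅) hgt he hd
      (Set.subset_union_left (t := {(s, t)})) hR''
      (fun E₀ e' he' hd' => by
        rw [Set.union_empty]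
        exact .single (.orient E₀ R' s t e' he' hd' hst))
      (fun E₀ e' he' hd' => by
        have := KB.orient (B := B) E₀ (R' ∪ {(s, t)}) s t e' he' hd' hst
        rw [Set.union_assoc, Set.union_self] at this
        rw [Set.union_empty]
        exact .single this)
    rw [Set.union_empty] at h₂
    refine ⟨E'', _, h₁, hR'', ?_, h₂.symm, h₂.exact⟩
    rintro l r (hlr | hlr)
    · exact h₂.leadsTo l r hlr
    · exact .of_mem (.inr hlr)
  | delete E R s t hd hst =>
    have hdel : ∀ E₀ e', e' = (s, t) ∨ e' = (t, s) → e' ∉ E₀ →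
        Relation.ReflTransGen (KB B gt) (E₀ ∪ {e'}, R') (E₀ ∪ ∅, R') := by
      rintro E₀ e' (rfl | rfl) hd' <;> rw [Set.union_empty]
      · exact .single (.delete E₀ R' s t hd' hst)
      · exact .single (.delete E₀ R' t s hd' hst.symm)
    obtain ⟨E'', h₁, h₂⟩ := h.exists_replace (X := ∅) hgt (.inl rfl) hd subset_rfl h.oriented
      hdel hdel
    rw [Set.union_empty] at h₂
    exact ⟨E'', R', h₁, h₂⟩
  | simplify E R s t u e he hd hst =>
    have hsu := transGen_of_stepMod h.leadsTo hst
    have hsimp := fun E₀ e' he' hd' =>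
      KB.simplify_transGen hgt h.oriented hsu t e' he' E₀ hd'
    obtain ⟨E'', h₁, h₂⟩ := h.exists_replace (X := {(u, t)}) hgt he hd subset_rfl h.oriented
      hsimp hsimp
    exact ⟨E'', R', h₁, h₂⟩
  | collapse E R s t u hd hst =>
    have h' : Simulates B gt E' R' E R :=
      ⟨h.oriented, fun l r hlr => h.leadsTo l r (.inl hlr), h.symm, h.exact⟩
    obtain ⟨E'', h₁, h₂⟩ := h'.exists_add hgt ⟨s, h'.leadsTo_step hst, h.leadsTo s t (.inr rfl)⟩
    exact ⟨E'', R', h₁, h₂⟩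
  | compose E R s t u hd hst =>
    refine ⟨E', R', .refl, h.oriented, ?_, h.symm, h.exact⟩
    rintro l r (hlr | hlr)
    · exact h.leadsTo l r (.inl hlr)
    · obtain ⟨rfl, rfl⟩ := Prod.mk.inj hlr
      exact (h.leadsTo l t (.inr rfl)).trans
        (transGen_of_stepMod (fun l r hlr => h.leadsTo l r (.inl hlr)) hst).to_reflTransGen

end Simulates

/-- Soundness of general completion. -/
theorem KB.eqTheory_of_mem {T : Set (Term ar V × Term ar V)}
    (hB : ∀ s t, (s, t) ∈ B → EqTheory T s t) {st st' : State ar V}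
    (h : Relation.ReflTransGen (KB B gt) st st')
    (hT : ∀ s t, (s, t) ∈ st.1 ∪ st.2 → EqTheory T s t) :
    ∀ s t, (s, t) ∈ st'.1 ∪ st'.2 → EqTheory T s t := by
  induction h with
  | refl => exact hT
  | tail _ h ih =>
    clear hT
    have hS : ∀ {R : Set (Term ar V × Term ar V)}, (∀ s t, (s, t) ∈ R → EqTheory T s t) →
        ∀ {s t}, StepMod R B s t → EqTheory T s t := by
      rintro R hR s t ⟨a, b, h₁, h₂, h₃⟩
      exact (EqTheory.le hB h₁).trans ((EqTheory.le hR (.of_step h₂)).trans (EqTheory.le hB h₃))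
    have hE : ∀ {E : Set (Term ar V × Term ar V)} {e : Term ar V × Term ar V} {s t},
        (∀ s t, (s, t) ∈ E ∪ {e} → EqTheory T s t) → e = (s, t) ∨ e = (t, s) →
        EqTheory T s t := by
      rintro E e s t h (rfl | rfl)
      exacts [h _ _ (.inr rfl), (h _ _ (.inr rfl)).symm]
    cases h with
    | deduce E R s m m' t h₁ h₂ h₃ =>
      have hR := fun s t (h : (s, t) ∈ R) => ih s t (.inr h)
      rintro a b ((h | h) | h)
      · exact ih a b (.inl h)
      · obtain ⟨rfl, rfl⟩ := Prod.mk.inj h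
        exact (EqTheory.le hR (.of_step h₁)).symm.trans
          ((EqTheory.le hB h₂).trans (EqTheory.le hR (.of_step h₃)))
      · exact hR a b h
    | orient E R s t e he hd h =>
      rintro a b (h' | h' | h')
      · exact ih a b (.inl (.inl h'))
      · exact ih a b (.inr h')
      · obtain ⟨rfl, rfl⟩ := Prod.mk.inj h'
        exact hE (fun s t h => ih s t (.inl h)) he
    | delete E R s t hd h =>
      rintro a b (h' | h')
      exacts [ih a b (.inl (.inl h')), ih a b (.inr h')]
    | simplify E R s t u e he hd h =>
      rintro a b ((h' | h') | h')
      · exact ih a b (.inl (.inl h'))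
      · obtain ⟨rfl, rfl⟩ := Prod.mk.inj h'
        exact (hS (fun s t h => ih s t (.inr h)) h).symm.trans
          (hE (fun s t h => ih s t (.inl h)) he)
      · exact ih a b (.inr h')
    | collapse E R s t u hd h =>
      rintro a b ((h' | h') | h')
      · exact ih a b (.inl h')
      · obtain ⟨rfl, rfl⟩ := Prod.mk.inj h'
        exact (hS (fun s t h => ih s t (.inr (.inl h))) h).symm.trans (ih s b (.inr (.inr rfl)))
      · exact ih a b (.inr (.inl h'))
    | compose E R s t u hd h =>
      rintro a b (h' | h' | h')
      · exact ih a b (.inl h')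
      · exact ih a b (.inr (.inl h'))
      · obtain ⟨rfl, rfl⟩ := Prod.mk.inj h'
        exact (ih a t (.inr (.inr rfl))).trans (hS (fun s t h => ih s t (.inr (.inl h))) h)

/-- A run of left-linear completion is simulated step by step. -/
theorem IsRunIA.exists_simulation {n : ℕ} {E R : ℕ → Set (Term ar V × Term ar V)}
    (hgt : IsReductionOrder B gt) (h : IsRunIA B gt n E R) :
    ∃ E' R' : ℕ → Set (Term ar V × Term ar V), E' 0 = E 0 ∧ R' 0 = ∅ ∧
      (∀ i < n, Relation.ReflTransGen (KB B gt) (E' i, R' i) (E' (i + 1), R' (i + 1))) ∧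
      ∀ i ≤ n, Simulates B gt (E' i) (R' i) (E i) (R i) := by
  suffices H : ∀ k ≤ n, ∃ E' R' : ℕ → Set (Term ar V × Term ar V), E' 0 = E 0 ∧ R' 0 = ∅ ∧
      (∀ i < k, Relation.ReflTransGen (KB B gt) (E' i, R' i) (E' (i + 1), R' (i + 1))) ∧
      ∀ i ≤ k, Simulates B gt (E' i) (R' i) (E i) (R i) from H n le_rfl
  intro k hk
  induction k with
  | zero =>
    refine ⟨fun _ => E 0, fun _ => ∅, rfl, rfl, by simp, fun i hi => ?_⟩
    obtain rfl := Nat.le_zero.1 hi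
    rw [h.1]
    exact ⟨by simp, by simp, fun _ _ => Iff.rfl, fun _ _ _ => Iff.rfl⟩
  | succ k ih =>
    obtain ⟨E', R', hE', hR', hstep, hsim⟩ := ih (by omega)
    obtain ⟨E'', R'', h₁, h₂⟩ := (hsim k le_rfl).exists_of_IA hgt (h.2 k hk)
    refine ⟨fun i => if i ≤ k then E' i else E'', fun i => if i ≤ k then R' i else R'',
      by simpa using hE', by simpa using hR', fun i hi => ?_, fun i hi => ?_⟩
    · by_cases hik : i < k
      · simpa [hik.le, Nat.succ_le_of_lt hik] using hstep i hik
      · obtain rfl : i = k := by omega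
        simpa using h₁
    · by_cases hik : i ≤ k
      · simpa [hik] using hsim i hik
      · obtain rfl : i = k + 1 := by omega
        simpa using h₂

end Simulation

/-! ### Completeness -/

/-- If `R` is Church–Rosser modulo `B` and its rules are simulated by `R'` modulo `B`, and `R'` is
valid in the theory of `R`, then `R'/B` is complete modulo `B`. -/
theorem completeModulo_of_leadsTo {F : Type u} {ar : F → ℕ} {V : Type v}
    {B R R' : Set (Term ar V × Term ar V)} {gt : Term ar V → Term ar V → Prop}
    (hgt : IsReductionOrder B gt) (hR' : ∀ l r, (l, r) ∈ R' → gt l r)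
    (hlead : ∀ l r, (l, r) ∈ R → LeadsTo R' B l r)
    (hvalid : ∀ l r, (l, r) ∈ R' → EqTheory (R ∪ B) l r)
    (hcr : ChurchRosserModulo (Step R) (EqTheory B)) :
    CompleteModulo (StepMod R' B) (EqTheory B) := by
  constructor
  · rintro ⟨a, ha⟩
    refine hgt.wf ⟨a, fun i => ?_⟩
    obtain ⟨s, t, h₁, h₂, h₃⟩ := ha i
    exact hgt.compat _ _ _ _ h₁ (hgt.gt_of_stepMod hR' h₂) h₃
  · intro a b hab
    have hB : ∀ {s t}, EqTheory B s t → EqTheory (R ∪ B) s t :=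
      fun h => h.mono Set.subset_union_right
    have hM : ∀ {s t}, StepMod R' B s t → EqTheory (R ∪ B) s t := by
      rintro s t ⟨c, d, h₁, h₂, h₃⟩
      exact (hB h₁).trans ((EqTheory.le hvalid (.of_step h₂)).trans (hB h₃))
    have hconv : EqTheory (R ∪ B) a b := by
      induction hab with
      | refl => exact .refl _
      | tail _ h ih =>
        rcases h with h | h | h
        exacts [ih.trans (hM h), ih.trans (hM h).symm, ih.trans (hB h)]
    have hcm : ConvModulo (Step R) (EqTheory B) a b := by
      refine Relation.ReflTransGen.mono (fun s t h => ?_) _ _ hconv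
      rcases h with h | h <;> rcases step_union_iff.1 h with h | h
      exacts [.inl h, .inr (.inr (.of_step h)), .inr (.inl h), .inr (.inr (EqTheory.of_step h).symm)]
    obtain ⟨c, d, hc, hcd, hd⟩ := hcr a b hcm
    have lift : ∀ {s t}, Relation.ReflTransGen (Step R) s t →
        Relation.ReflTransGen (StepMod R' B) s t := by
      intro s t h
      induction h with
      | refl => exact .refl
      | tail _ h ih =>
        exact ih.trans (LeadsTo.isRewriteRel.step_le hlead h).transGen.to_reflTransGen
    exact ⟨c, d, lift hc, hcd, lift hd⟩

end ACCompletion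

open ACCompletion
theorem mainTheorem8 {F V : Type*} [Infinite V] (ar : F → ℕ) (ac : Set F)
    (hac : ∀ f ∈ ac, ar f = 2)
    (gt : Term ar V → Term ar V → Prop) (hgt : IsReductionOrder (AC ac) gt)
    (n : ℕ) (E R : ℕ → Set (Term ar V × Term ar V)) (hrun : IsRunIA (AC ac) gt n E R) :
    ∃ E' R' : ℕ → Set (Term ar V × Term ar V),
      E' 0 = E 0 ∧ R' 0 = ∅ ∧
      (∀ i < n, Relation.ReflTransGen (KB (AC ac) gt) (E' i, R' i) (E' (i + 1), R' (i + 1))) ∧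
      (∀ i ≤ n, IsTRS (R' i) ∧ symmEqs (E' i) = symmEqs (E i) ∧
        ∀ l r, (l, r) ∈ R i → Relation.TransGen (StepMod (R' i) (AC ac)) l r) ∧
      (IsFairIA (AC ac) n E R → E n = ∅ →
        Relation.ReflTransGen (KB (AC ac) gt) (E 0, ∅) (∅, R' n) ∧
        IsCompletePresentationMod (AC ac) (R' n) (E 0)) := by
  obtain ⟨E', R', hE', hR', hstep, hsim⟩ := hrun.exists_simulation hgt
  refine ⟨E', R', hE', hR', hstep, fun i hi => ⟨hgt.isTRS (hsim i hi).oriented, ?_,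
    fun l r hlr => ((hsim i hi).leadsTo l r hlr).transGen⟩, fun hfair hn => ?_⟩
  · ext ⟨a, b⟩
    exact (hsim i hi).symm a b
  · have hrunKB : ∀ i ≤ n, Relation.ReflTransGen (KB (AC ac) gt) (E 0, ∅) (E' i, R' i) := by
      intro i hi
      induction i with
      | zero => rw [hE', hR']
      | succ i ih => exact (ih (by omega)).trans (hstep i hi)
    have hE'n : E' n = ∅ := by
      refine Set.eq_empty_of_forall_notMem fun ⟨a, b⟩ hab => ?_
      have := ((hsim n le_rfl).symm a b).1 (.inl hab)
      rw [hn] at this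
      exact this.elim id id
    have hrunKB := hrunKB n le_rfl
    rw [hE'n] at hrunKB
    -- the systems `E 0`, `R n` and `R' n` have the same theory, together with the equations `AC`
    have sound : ∀ l r, (l, r) ∈ R' n → EqTheory (E 0 ∪ AC ac) l r := fun l r hlr =>
      KB.eqTheory_of_mem (fun s t h => .of_step (step_of_mem (.inr h))) hrunKB
        (fun s t h => .of_step (step_of_mem (.inl (h.resolve_right id)))) l r (.inr hlr)
    have complete : ∀ l r, (l, r) ∈ E 0 → EqTheory (R n ∪ AC ac) l r := fun l r hlr => by
      have := hrun.eqTheory_of_mem (Nat.zero_le n) l r (.inl hlr)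
      rwa [hn, Set.empty_union] at this
    have hAC : ∀ S : Set (Term ar V × Term ar V), ∀ s t, (s, t) ∈ AC (V := V) ac →
        EqTheory (S ∪ AC ac) s t := fun S s t h => .of_step (step_of_mem (.inr h))
    have lead : ∀ l r, (l, r) ∈ R n → EqTheory (R' n ∪ AC ac) l r := by
      intro l r hlr
      have mod : ∀ {s t}, StepMod (R' n) (AC ac) s t → EqTheory (R' n ∪ AC ac) s t := by
        rintro s t ⟨c, d, h₁, h₂, h₃⟩
        exact (EqTheory.le (hAC _) h₁).trans
          ((EqTheory.of_step (h₂.mono Set.subset_union_left)).trans (EqTheory.le (hAC _) h₃))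
      exact Relation.TransGen.trans_induction_on ((hsim n le_rfl).leadsTo l r hlr).transGen
        mod fun _ _ => EqTheory.trans
    have le : ∀ {S T : Set (Term ar V × Term ar V)},
        (∀ l r, (l, r) ∈ S → EqTheory (T ∪ AC ac) l r) →
        ∀ {s t}, EqTheory (S ∪ AC ac) s t → EqTheory (T ∪ AC ac) s t := fun h =>
      EqTheory.le fun s t hst => hst.elim (h s t) (hAC _ s t)
    have hcr := (hrun.primeCriticalConditions hgt
      (fun l r => linear_of_mem_symmEqs_AC hac) hfair hn).churchRosserModulo
    exact ⟨hrunKB, completeModulo_of_leadsTo hgt (hsim n le_rfl).oriented (hsim n le_rfl).leadsTo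
      (fun l r hlr => le complete (sound l r hlr)) hcr,
      fun s t => ⟨fun h => le lead (le complete h), le sound⟩⟩
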